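/- Let $BO_n$ be the Grassmannian of $n$-dimensional subspaces of $\mathbb R^\infty$ (with the colimit topology), $\gamma_n$ its tautological bundle, and for $d\le e$ let $BO_d\to BO_e$ be the usual inclusion $V\mapsto\mathbb R^{e-d}\oplus V\subset\mathbb R^{e-d}\oplus\mathbb R^\infty=\mathbb R^\infty$. A map $f$ to $BO_n$ classifies an $n$-dimensional real vector bundle $\theta$ if $\theta\cong f^*\gamma_n$. If $\theta$ is a real vector bundle of dimension $D$ over a space containing subspaces $X_0\subset\cdots\subset X_k$, and $d_0\le\dots\le d_k\le D$ are natural numbers, we say that $\mathrm{gd}(\theta|X_i)\le d_i$ compatibly for $i\le k$ if there is a (strictly) commutative diagram $$\begin{array}{ccccccccc} X_0&\to& X_1&\to&\cdots&\to& X_k&&\\ \downarrow&&\downarrow&&&&\downarrow&&\\ BO_{d_0}&\to& BO_{d_1}&\to&\cdots&\to& BO_{d_k}&\to& BO_D\end{array}$$ in which the horizontal maps are the inclusions and the composite $X_k\to BO_D$ classifies $\theta|X_k$. Such a diagram, with the isomorphism of $\theta|X_k$ with the pullback of $\gamma_D$, identifies $\theta|X_j$ with $\mathbb R^{D-d_j}\oplus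 f_j^*\gamma_{d_j}$, where $f_j\colon X_j\to BO_{d_j}$ is the $j$-th vertical map. **Proposition.** Let $X$ and $Y$ be compact Hausdorff spaces with closed subsets $X_0\subset\cdots\subset X_k\subset X$ and $Y_0\subset\cdots\subset Y_k\subset Y$, and let $\theta$ and $\eta$ be finite-dimensional real vector bundles over $X$ and $Y$, each of constant dimension. Suppose that $\mathrm{gd}(\theta|X_i)\le d_i$ compatibly for $i\le k$ and $\mathrm{gd}(\eta|Y_i)\le d'_i$ compatibly for $i\le k$. For $0\le j\le k$ let $$(X\times Y)_j=\bigcup_{i=0}^{j}X_i\times Y_{j-i},\qquad e_j=\max\{d_i+d'_{j-i}:0\le i\le j\}.$$ Then $\mathrm{gd}(\theta\times\eta\,|\,(X\times Y)_j)\le e_j$ compatibly for $j\le k$. Moreover, if $X=Y$, $X_i=Y_i$, $d_i=d'_i$ and $\theta=\eta$, then the diagram of maps $f_j\colon(X\times X)_j\to BO_{e_j}$ (and the isomorphism of $\theta\times\theta$ on $(X\times X)_k$ with the pullback of the tautological bundle) can be chosen invariant under the interchange $T(x,y)=(y,x)$ in the following sense: for every $j\le k$, 1. $f_j\circ T\simeq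 f_j$ as maps $(X\times X)_j\to BO_{e_j}$; 2. the $e_j$-dimensional subbundle of $\theta\times\theta\,|\,(X\times X)_j$ corresponding to the summand $f_j^*\gamma_{e_j}$ is mapped to itself by the involution $\theta_x\oplus\theta_y\to\theta_y\oplus\theta_x$, $(a,b)\mapsto(b,a)$, which covers $T$. -/

import Mathlib

open Bundle Topology

noncomputable section

namespace CompatGD

/-- The vector space `ℝ^∞` of finitely supported real sequences. -/
abbrev RInf : Type := ℕ →₀ ℝ

/-- The standard inclusion `ℝ^N → ℝ^∞`. -/
def RInf.ofFin (N : ℕ) : (Fin N → ℝ) →ₗ[ℝ] RInf :=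
  Finsupp.lmapDomain ℝ ℝ (Fin.val : Fin N → ℕ) ∘ₗ
    (Finsupp.linearEquivFunOnFinite ℝ ℝ (Fin N)).symm.toLinearMap

/-- The topology of `ℝ^∞` is the colimit topology of the finite-dimensional spaces `ℝ^N`. -/
instance RInf.instTopologicalSpace : TopologicalSpace RInf :=
  ⨆ N : ℕ, TopologicalSpace.coinduced (RInf.ofFin N) inferInstance

/-- Deleting the first `m` coordinates, `(w₀, w₁, …) ↦ (w_m, w_{m+1}, …)`. -/
def RInf.drop (m : ℕ) : RInf →ₗ[ℝ] RInf :=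
  Finsupp.lcomapDomain (fun q : ℕ => q + m) (add_left_injective m)

theorem RInf.ofFin_injective (N : ℕ) : Function.Injective (RInf.ofFin N) := by
  intro v w h
  have h' : Finsupp.mapDomain (Fin.val : Fin N → ℕ)
      ((Finsupp.linearEquivFunOnFinite ℝ ℝ (Fin N)).symm v) =
    Finsupp.mapDomain (Fin.val : Fin N → ℕ)
      ((Finsupp.linearEquivFunOnFinite ℝ ℝ (Fin N)).symm w) := h
  exact (Finsupp.linearEquivFunOnFinite ℝ ℝ (Fin N)).symm.injective
    (Finsupp.mapDomain_injective Fin.val_injective h')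

theorem RInf.drop_apply (m : ℕ) (w : RInf) (q : ℕ) : RInf.drop m w q = w (q + m) := rfl

theorem RInf.ofFin_apply_of_lt (N : ℕ) (v : Fin N → ℝ) (i : Fin N) :
    RInf.ofFin N v i = v i := by
  have : RInf.ofFin N v i = Finsupp.mapDomain (Fin.val : Fin N → ℕ)
      ((Finsupp.linearEquivFunOnFinite ℝ ℝ (Fin N)).symm v) i.val := rfl
  rw [this, Finsupp.mapDomain_apply Fin.val_injective]
  rfl

theorem RInf.ofFin_apply_of_le (N : ℕ) (v : Fin N → ℝ) (q : ℕ) (hq : N ≤ q) :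
    RInf.ofFin N v q = 0 := by
  have : RInf.ofFin N v q = Finsupp.mapDomain (Fin.val : Fin N → ℕ)
      ((Finsupp.linearEquivFunOnFinite ℝ ℝ (Fin N)).symm v) q := rfl
  rw [this, Finsupp.mapDomain_of_notMem_range]
  rintro ⟨i, rfl⟩
  exact absurd i.isLt (not_lt.mpr hq)

/-- The (underlying set of the) classifying space `BO_n`: the infinite real Grassmannian of
`n`-dimensional linear subspaces of `ℝ^∞`. -/
@[ext] structure BO (n : ℕ) where
  /-- the `n`-dimensional subspace -/
  carrier : Submodule ℝ RInf
  finite : Module.Finite ℝ carrier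
  finrank_eq : Module.finrank ℝ carrier = n

/-- The subspace spanned by an `n`-frame in `ℝ^N ⊆ ℝ^∞`. -/
def BO.ofFrame (n N : ℕ) (v : {v : Fin n → (Fin N → ℝ) // LinearIndependent ℝ v}) : BO n where
  carrier := Submodule.span ℝ (Set.range fun i => RInf.ofFin N (v.1 i))
  finite := Module.Finite.span_of_finite ℝ (Set.finite_range _)
  finrank_eq := by
    have h : LinearIndependent ℝ fun i => RInf.ofFin N (v.1 i) :=
      v.2.map' (RInf.ofFin N) (LinearMap.ker_eq_bot.mpr (RInf.ofFin_injective N))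
    simpa using finrank_span_eq_card h

/-- The topology of `BO_n`: the colimit over `N` of the Grassmannians of `ℝ^N`, each with the
quotient topology from the space of `n`-frames in `ℝ^N`. -/
instance BO.instTopologicalSpace (n : ℕ) : TopologicalSpace (BO n) :=
  ⨆ N : ℕ, TopologicalSpace.coinduced (BO.ofFrame n N) inferInstance

/-- The linear identification of `ℝ^m ⊕ V ⊆ ℝ^m ⊕ ℝ^∞ = ℝ^∞` with `ℝ^m × V`. -/
def stabEquiv (m : ℕ) (V : Submodule ℝ RInf) :
    V.comap (RInf.drop m) ≃ₗ[ℝ] (Fin m → ℝ) × V :=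
  LinearEquiv.ofBijective
    { toFun := fun w => (fun i => w.1 i, ⟨RInf.drop m w.1, w.2⟩)
      map_add' := fun _ _ => by
        ext <;> simp
      map_smul' := fun _ _ => by
        ext <;> simp }
    (by
      constructor
      · intro w w' h
        have h1 := congrArg Prod.fst h
        have h2 := congrArg (fun p => (p.2 : RInf)) h
        ext q
        by_cases hq : q < m
        · exact congrFun h1 ⟨q, hq⟩
        · have h3 := DFunLike.congr_fun h2 (q - m)
          simp only [LinearMap.coe_mk, AddHom.coe_mk, RInf.drop_apply] at h3
          rwa [Nat.sub_add_cancel (not_lt.mp hq)] at h3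
      · rintro ⟨a, w, hw⟩
        have hd : RInf.drop m (RInf.ofFin m a + Finsupp.mapDomain (fun q => q + m) w) = w := by
          ext q
          rw [RInf.drop_apply, Finsupp.add_apply, RInf.ofFin_apply_of_le _ _ _ (by omega),
            zero_add]
          exact Finsupp.mapDomain_apply (add_left_injective m) w q
        refine ⟨⟨RInf.ofFin m a + Finsupp.mapDomain (fun q => q + m) w, ?_⟩, ?_⟩
        · rw [Submodule.mem_comap, hd]; exact hw
        · refine Prod.ext ?_ (Subtype.ext hd)
          funext i
          change (RInf.ofFin m a + Finsupp.mapDomain (fun q => q + m) w) i = a i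
          rw [Finsupp.add_apply, RInf.ofFin_apply_of_lt, Finsupp.mapDomain_of_notMem_range, add_zero]
          rintro ⟨q, hq⟩
          have := i.isLt
          simp only at hq
          omega)

/-- The usual inclusion `BO_d → BO_e` for `d ≤ e`: it sends `V ⊆ ℝ^∞` to
`ℝ^(e-d) ⊕ V ⊆ ℝ^(e-d) ⊕ ℝ^∞ = ℝ^∞`, that is, to the space of the sequences that lie in `V`
after the first `e - d` coordinates have been deleted. -/
def BO.incl {d e : ℕ} (h : d ≤ e) (V : BO d) : BO e where
  carrier := V.carrier.comap (RInf.drop (e - d))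
  finite := by
    have := V.finite
    exact Module.Finite.equiv (stabEquiv (e - d) V.carrier).symm
  finrank_eq := by
    have := V.finite
    have : Module.Free ℝ V.carrier := Module.Free.of_divisionRing ℝ V.carrier
    rw [(stabEquiv (e - d) V.carrier).finrank_eq, Module.finrank_prod, V.finrank_eq,
      Module.finrank_fin_fun]
    omega

/-- A bundle map from the restriction `E|_A` of a vector bundle to the tautological bundle
`γ_n = {(V, v) : v ∈ V} ⊆ BO_n × ℝ^∞` that covers `f : A → BO_n`: a continuous map of total
spaces which is a linear isomorphism on every fibre. In other words, an isomorphism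
`E|_A ≅ f^*γ_n`; `f` classifies `E|_A` if there is one. -/
structure TautMap {B : Type*} [TopologicalSpace B] (F : Type*) [NormedAddCommGroup F]
    [NormedSpace ℝ F] (E : B → Type*) [∀ x, AddCommMonoid (E x)] [∀ x, Module ℝ (E x)]
    [TopologicalSpace (TotalSpace F E)] (A : Set B) {n : ℕ} (f : A → BO n) where
  /-- the isomorphisms of the fibres -/
  fibre : ∀ x : A, E x ≃ₗ[ℝ] (f x).carrier
  continuous_total : Continuous fun p : {p : TotalSpace F E // p.proj ∈ A} =>
    ((f ⟨p.1.proj, p.2⟩, (fibre ⟨p.1.proj, p.2⟩ p.1.2 : RInf)) : BO n × RInf)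

/-- Let `E` be a vector bundle with model fibre `F` (so of dimension `dim F`) over a space `B`
with subsets `A 0 ⊆ ⋯ ⊆ A k` (only the indices `i ≤ k` matter). A compatible system of liftings is
a strictly commutative diagram
```
A 0     ⟶  A 1     ⟶  ⋯  ⟶  A k
 ↓           ↓                 ↓
BO_{d 0} ⟶ BO_{d 1} ⟶ ⋯ ⟶ BO_{d k} ⟶ BO_{dim F}
```
in which the horizontal maps are the inclusions and `A k → BO_{dim F}` classifies `E|_{A k}`. -/
structure CompatLift {B : Type*} [TopologicalSpace B] (F : Type*) [NormedAddCommGroup F]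
    [NormedSpace ℝ F] (E : B → Type*) [∀ x, AddCommMonoid (E x)] [∀ x, Module ℝ (E x)]
    [TopologicalSpace (TotalSpace F E)] (k : ℕ) (A : ℕ → Set B) (d : ℕ → ℕ) where
  le_succ : ∀ i < k, d i ≤ d (i + 1)
  le_dim : d k ≤ Module.finrank ℝ F
  /-- the vertical maps -/
  map : ∀ i, C(A i, BO (d i))
  comm : ∀ (i : ℕ) (hi : i < k) (x : B) (hx : x ∈ A i) (hx' : x ∈ A (i + 1)),
    map (i + 1) ⟨x, hx'⟩ = BO.incl (le_succ i hi) (map i ⟨x, hx⟩)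
  /-- the composite `A k → BO_{d k} → BO_{dim F}` classifies `E|_{A k}` -/
  classify : TautMap F E (A k) fun x => BO.incl le_dim (map k x)

/-- `gd(E|_{A i}) ≤ d i` compatibly for `i ≤ k`. -/
def GdLECompatibly {B : Type*} [TopologicalSpace B] (F : Type*) [NormedAddCommGroup F]
    [NormedSpace ℝ F] (E : B → Type*) [∀ x, AddCommMonoid (E x)] [∀ x, Module ℝ (E x)]
    [TopologicalSpace (TotalSpace F E)] (k : ℕ) (A : ℕ → Set B) (d : ℕ → ℕ) : Prop :=
  Nonempty (CompatLift F E k A d)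

/-- A compatible system of liftings identifies `E|_{A j}` with `ℝ^(dim F - d j) ⊕ f_j^*γ_{d j}`,
where `f_j : A j → BO_{d j}` is the `j`-th lifting. This is the fibre at `x` of the
`d j`-dimensional subbundle of `E|_{A j}` that corresponds to the summand `f_j^*γ_{d j}`. It
consists of the vectors whose first `dim F - d j` coordinates in `ℝ^∞` vanish. -/
def CompatLift.sub {B : Type*} [TopologicalSpace B] {F : Type*} [NormedAddCommGroup F]
    [NormedSpace ℝ F] {E : B → Type*} [∀ x, AddCommMonoid (E x)] [∀ x, Module ℝ (E x)]
    [TopologicalSpace (TotalSpace F E)] {k : ℕ} {A : ℕ → Set B} {d : ℕ → ℕ}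
    (L : CompatLift F E k A d) (j : ℕ) (x : A k) : Submodule ℝ (E x) where
  carrier := {v | ∀ q < Module.finrank ℝ F - d j, (L.classify.fibre x v : RInf) q = 0}
  zero_mem' := fun q _ => by simp
  add_mem' := fun {v w} hv hw q hq => by simp [hv q hq, hw q hq]
  smul_mem' := fun c v hv q hq => by simp [hv q hq]

/-- A filtration `A 0 ⊆ ⋯ ⊆ A k` of (a part of) a space by closed subsets. -/
structure IsClosedFiltration {B : Type*} [TopologicalSpace B] (k : ℕ) (A : ℕ → Set B) : Prop where
  isClosed : ∀ i ≤ k, IsClosed (A i)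
  subset_succ : ∀ i < k, A i ⊆ A (i + 1)

/-- The product filtration `(X × Y)_j = ⋃_{i ≤ j} X_i × Y_{j-i}`. -/
def prodFiltration {X Y : Type*} (A : ℕ → Set X) (A' : ℕ → Set Y) (j : ℕ) : Set (X × Y) :=
  ⋃ i ∈ Finset.range (j + 1), A i ×ˢ A' (j - i)

/-- `e_j = max (d_i + d'_{j-i} : 0 ≤ i ≤ j)`. -/
def convMax (d d' : ℕ → ℕ) (j : ℕ) : ℕ :=
  (Finset.range (j + 1)).sup fun i => d i + d' (j - i)

/-- The external product `θ × η` over `X × Y`, with fibre `θ_x ⊕ η_y` at `(x, y)`. -/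
abbrev extProd {X Y : Type*} [TopologicalSpace X] [TopologicalSpace Y]
    (E : X → Type*) (E' : Y → Type*) : X × Y → Type _ :=
  ((ContinuousMap.fst : C(X × Y, X)) *ᵖ E) ×ᵇ ((ContinuousMap.snd : C(X × Y, Y)) *ᵖ E')

theorem swap_mem_prodFiltration {X : Type*} {A : ℕ → Set X} {j : ℕ} {p : X × X}
    (hp : p ∈ prodFiltration A A j) : p.swap ∈ prodFiltration A A j := by
  simp only [prodFiltration, Set.mem_iUnion, Finset.mem_range, Set.mem_prod] at hp ⊢
  obtain ⟨i, hi, h1, h2⟩ := hp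
  refine ⟨j - i, by omega, h2, ?_⟩
  rwa [show j - (j - i) = i by omega]

/-- The interchange of factors `T : (X × X)_j → (X × X)_j`. -/
def swapMap {X : Type*} [TopologicalSpace X] (A : ℕ → Set X) (j : ℕ) :
    C(prodFiltration A A j, prodFiltration A A j) where
  toFun p := ⟨p.1.swap, swap_mem_prodFiltration p.2⟩
  continuous_toFun := by fun_prop

end CompatGD

end

/-!
A compatible system of liftings embeds `θ` over the compact space `X_k` into `ℝ^∞` so that the image
of the fibre at `x ∈ X_i` contains the first `dim θ - d_i` standard basis vectors. Finitely many
coordinates suffice (`CompatLift.exists_embedding`), so `θ_x` becomes a subspace `W x` of some `ℝ^N`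
and `η_y` a subspace `W' y` of some `ℝ^N'`. Conversely, `CompatLift.exists_of_embedding` turns an
embedding of this kind into a compatible system of liftings. So `θ × η` has to be embedded in `ℝ^∞`
such that, over `(X × Y)_j`, the image contains the first `c_j = dim θ + dim η - e_j` standard basis
vectors.

Over `X_i × Y_(j-i)` the sum `W x ⊕ W' y` contains the first `a` and the first `b` basis vectors of
the two summands, where `a + b ≥ c_j`, but `a` and `b` change with `i`. The vectors `w_t` whose
components are the Taylor coefficients of the monomial `z ^ t` at `1` and at `-1` serve all pairs
`(a, b)` at once: a polynomial of degree less than `a + b` that vanishes to order `a` at `1` and to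
order `b` at `-1` is zero (`eq_zero_of_taylor_eq_zero`), and hence the orthogonal projections of
`w_0, …, w_(c_j - 1)` to `W x ⊕ W' y` are independent
(`linearIndependent_sumProj_hermiteVector`). As the `w_t` do not depend on `j`, these frames are
compatible. Over the rest of the space the projections may be dependent, so they are
orthogonalized by a Gram–Schmidt process with cut-offs, `cutoffGramSchmidt`, which is continuous
everywhere and yields unit vectors `u_t` where this is needed; each of these unit vectors is
orthogonal to all other vectors of the sequence. The map `v ↦ (⟨u_t, v⟩)_t ⊕ (v - ∑ ⟨u_t, v⟩ u_t)`
is injective and sends `u_t` to the `t`-th basis vector wherever `u_t` has been normalized.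

The substitution of `-z` for `z` interchanges `1` and `-1`, so for `θ = η` the interchange of the
summands multiplies `w_t`, and with it `u_t`, by `(-1) ^ t`. Therefore the common kernel of the first
`c_j` coordinates is invariant. The maps `f_j` and `f_j ∘ T` are the ranges of two families of linear
maps with the same kernels, and such ranges are homotopic in the Grassmannian of `ℝ^∞`
(`IsContFamily.homotopic`).
-/

namespace CompatGD

/-! ### Families of linear maps into `ℝ^∞` and maps to Grassmannians -/

theorem RInf.drop_drop (m n : ℕ) (w : RInf) : RInf.drop m (RInf.drop n w) = RInf.drop (m + n) w := by
  ext q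
  simp only [RInf.drop_apply, add_assoc]

theorem RInf.continuous_ofFin (N : ℕ) : Continuous (RInf.ofFin N) :=
  continuous_iff_coinduced_le.2 (le_iSup
    (fun N => TopologicalSpace.coinduced (RInf.ofFin N) inferInstance) N)

theorem RInf.continuous_apply (q : ℕ) : Continuous fun w : RInf => w q := by
  refine continuous_iSup_dom.2 fun N => continuous_coinduced_dom.2 ?_
  by_cases hq : q < N
  · exact (_root_.continuous_apply (⟨q, hq⟩ : Fin N)).congr fun v =>
      (RInf.ofFin_apply_of_lt N v ⟨q, hq⟩).symm
  · exact continuous_const.congr fun v => (RInf.ofFin_apply_of_le N v q (not_lt.1 hq)).symm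

theorem RInf.ofFin_trunc {K : ℕ} {w : RInf} (hw : ∀ q, K ≤ q → w q = 0) :
    RInf.ofFin K (fun i => w i) = w := by
  ext q
  by_cases hq : q < K
  · exact RInf.ofFin_apply_of_lt K _ ⟨q, hq⟩
  · rw [RInf.ofFin_apply_of_le _ _ _ (not_lt.1 hq), hw q (not_lt.1 hq)]

theorem BO.continuous_ofFrame (n N : ℕ) : Continuous (BO.ofFrame n N) :=
  continuous_iff_coinduced_le.2 (le_iSup
    (fun N => TopologicalSpace.coinduced (BO.ofFrame n N) inferInstance) N)

instance (n : ℕ) : Nonempty (BO n) :=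
  ⟨BO.ofFrame n n ⟨Pi.basisFun ℝ (Fin n), (Pi.basisFun ℝ (Fin n)).linearIndependent⟩⟩

/-- A family of linear maps `V → ℝ^∞` that is continuous for the topology of pointwise convergence
and takes its values in one finite stage `ℝ^K` of `ℝ^∞`. -/
def IsContFamily {Z V : Type*} [TopologicalSpace Z] [AddCommGroup V] [Module ℝ V]
    (R : Z → V →ₗ[ℝ] RInf) : Prop :=
  (∃ K, ∀ z v q, K ≤ q → R z v q = 0) ∧ ∀ v q, Continuous fun z => R z v q

section

variable {Z V : Type*} [TopologicalSpace Z] [AddCommGroup V] [Module ℝ V] {R R' : Z → V →ₗ[ℝ] RInf}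

theorem IsContFamily.drop (hR : IsContFamily R) (m : ℕ) :
    IsContFamily fun z => RInf.drop m ∘ₗ R z := by
  obtain ⟨⟨K, hK⟩, hc⟩ := hR
  exact ⟨⟨K, fun z v q hq => hK z v _ (Nat.le_add_right_of_le hq)⟩, fun v q => hc v (q + m)⟩

theorem IsContFamily.comp (hR : IsContFamily R) {Z' : Type*} [TopologicalSpace Z'] {g : Z' → Z}
    (hg : Continuous g) : IsContFamily fun z => R (g z) := by
  obtain ⟨⟨K, hK⟩, hc⟩ := hR
  exact ⟨⟨K, fun z => hK (g z)⟩, fun v q => (hc v q).comp hg⟩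

theorem IsContFamily.comp_linearMap (hR : IsContFamily R) {V' : Type*} [AddCommGroup V']
    [Module ℝ V'] (τ : V' →ₗ[ℝ] V) : IsContFamily fun z => R z ∘ₗ τ := by
  obtain ⟨⟨K, hK⟩, hc⟩ := hR
  exact ⟨⟨K, fun z v => hK z (τ v)⟩, fun v q => hc (τ v) q⟩

/-- The ranges of a continuous family of linear maps of constant rank `n` form a continuous map to
`BO_n`: near each point, the images of finitely many vectors form a frame of the range. -/
theorem IsContFamily.continuous_of_range (hR : IsContFamily R) {n : ℕ} {f : Z → BO n}
    (hf : ∀ z, (f z).carrier = LinearMap.range (R z)) : Continuous f := by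
  obtain ⟨⟨K, hK⟩, hc⟩ := hR
  refine continuous_iff_continuousAt.2 fun z₀ => ?_
  have := (f z₀).finite
  obtain ⟨b, hbli⟩ := exists_linearIndependent_of_le_finrank (R := ℝ) (M := (f z₀).carrier)
    (f z₀).finrank_eq.ge
  have hb : ∀ i, ∃ v, R z₀ v = b i := fun i => (hf z₀).le (b i).2
  choose v hv using hb
  let m : Z → Fin n → Fin K → ℝ := fun z i q => R z (v i) q
  have hm : Continuous m :=
    continuous_pi fun i => continuous_pi fun q => hc (v i) q
  have hofm : ∀ z i, RInf.ofFin K (m z i) = R z (v i) := fun z i =>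
    RInf.ofFin_trunc (hK z (v i))
  have h₀ : LinearIndependent ℝ (m z₀) := by
    refine LinearIndependent.of_comp (RInf.ofFin K) ?_
    have h : (RInf.ofFin K ∘ m z₀) = (f z₀).carrier.subtype ∘ b :=
      funext fun i => (hofm z₀ i).trans (hv i)
    rw [h]
    exact hbli.map_injOn (f z₀).carrier.subtype
      (Submodule.injective_subtype _).injOn
  obtain ⟨U, hUo, hzU, hU⟩ : ∃ U : Set Z, IsOpen U ∧ z₀ ∈ U ∧ ∀ z ∈ U, LinearIndependent ℝ (m z) :=
    ⟨_, isOpen_setOfPred_linearIndependent.preimage hm, h₀, fun z hz => hz⟩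
  have hcont : Continuous fun z : U => BO.ofFrame n K ⟨m z.1, hU z.1 z.2⟩ :=
    (BO.continuous_ofFrame n K).comp ((hm.comp continuous_subtype_val).subtype_mk _)
  refine ContinuousOn.continuousAt ?_ (hUo.mem_nhds hzU)
  rw [continuousOn_iff_continuous_domRestrict]
  refine hcont.congr fun z => ?_
  · have hfin := (f z.1).finite
    refine BO.ext ?_
    change _ = (f z.1).carrier
    refine Submodule.eq_of_le_of_finrank_eq ?_ ?_
    · refine Submodule.span_le.2 ?_
      rintro _ ⟨i, rfl⟩
      change RInf.ofFin K (m z.1 i) ∈ (f z.1).carrier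
      rw [hofm, hf]
      exact ⟨v i, rfl⟩
    · exact (BO.finrank_eq _).trans (f z.1).finrank_eq.symm

/-- Two continuous families of linear maps with the same kernels have homotopic ranges. The family
`(1 - s) R + s R' + s (1 - s) S R`, with `S` a shift of the coordinates past the supports of `R`
and `R'`, has the same kernels for every `s ∈ [0, 1]`. -/
theorem IsContFamily.homotopic (hR : IsContFamily R) (hR' : IsContFamily R')
    (hker : ∀ z, LinearMap.ker (R z) = LinearMap.ker (R' z)) {n : ℕ} {f f' : C(Z, BO n)}
    (hf : ∀ z, (f z).carrier = LinearMap.range (R z))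
    (hf' : ∀ z, (f' z).carrier = LinearMap.range (R' z)) : f.Homotopic f' := by
  obtain ⟨⟨K₁, hK₁⟩, hc⟩ := hR
  obtain ⟨⟨K₂, hK₂⟩, hc'⟩ := hR'
  let K := max K₁ K₂
  let S : RInf →ₗ[ℝ] RInf := Finsupp.lmapDomain ℝ ℝ (fun q : ℕ => q + K)
  have hS : ∀ w q, S w (q + K) = w q := fun w q =>
    Finsupp.mapDomain_apply (add_left_injective K) w q
  have hS' : ∀ w q, q < K → S w q = 0 := fun w q hq =>
    Finsupp.mapDomain_of_notMem_range _ _ (by rintro ⟨r, hr⟩; simp only at hr; omega)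
  let Q : unitInterval × Z → V →ₗ[ℝ] RInf := fun p =>
    (1 - (p.1 : ℝ)) • R p.2 + (p.1 : ℝ) • R' p.2 +
      ((p.1 : ℝ) * (1 - (p.1 : ℝ))) • (S ∘ₗ R p.2)
  have hQ : ∀ p v q, Q p v q = (1 - (p.1 : ℝ)) * R p.2 v q + (p.1 : ℝ) * R' p.2 v q +
      ((p.1 : ℝ) * (1 - (p.1 : ℝ))) * S (R p.2 v) q := fun p v q => by
    simp [Q]
  have hSK : ∀ w q, (∀ q, K ≤ q → w q = 0) → K + K ≤ q → S w q = 0 := fun w q hw hq => by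
    obtain ⟨r, rfl⟩ : ∃ r, q = r + K := ⟨q - K, by omega⟩
    rw [hS, hw r (by omega)]
  have hQc : IsContFamily Q := by
    refine ⟨⟨K + K, fun p v q hq => ?_⟩, fun v q => ?_⟩
    · rw [hQ, hK₁ _ _ _ (by omega), hK₂ _ _ _ (by omega), hSK _ _ _ hq]
      · simp
      · intro q hq
        exact hK₁ _ _ _ (by omega)
    · simp only [hQ]
      have h1 : Continuous fun p : unitInterval × Z => R p.2 v q := (hc v q).comp continuous_snd
      have h2 : Continuous fun p : unitInterval × Z => R' p.2 v q := (hc' v q).comp continuous_snd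
      have h3 : Continuous fun p : unitInterval × Z => S (R p.2 v) q := by
        by_cases hq : q < K
        · exact continuous_const.congr fun p => (hS' _ _ hq).symm
        · obtain ⟨r, rfl⟩ : ∃ r, q = r + K := ⟨q - K, by omega⟩
          simp only [hS]
          exact (hc v r).comp continuous_snd
      have h0 : Continuous fun p : unitInterval × Z => (p.1 : ℝ) :=
        continuous_subtype_val.comp continuous_fst
      exact (((continuous_const.sub h0).mul h1).add (h0.mul h2)).add
        ((h0.mul (continuous_const.sub h0)).mul h3)
  have hQker : ∀ p, LinearMap.ker (Q p) = LinearMap.ker (R p.2) := by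
    intro p
    ext v
    constructor
    · intro h
      have h0 : ∀ q, Q p v q = 0 := fun q => by rw [LinearMap.mem_ker.1 h]; rfl
      by_cases hs1 : (p.1 : ℝ) = 1
      · rw [hker]
        refine Finsupp.ext fun q => ?_
        simpa [hQ, hs1] using h0 q
      · by_cases hs0 : (p.1 : ℝ) = 0
        · refine Finsupp.ext fun q => ?_
          simpa [hQ, hs0] using h0 q
        · refine Finsupp.ext fun q => ?_
          have := h0 (q + K)
          rw [hQ, hK₁ _ _ _ (by omega), hK₂ _ _ _ (by omega), hS, mul_zero, mul_zero, zero_add,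
            zero_add] at this
          exact (mul_eq_zero.1 this).resolve_left
            (mul_ne_zero hs0 (sub_ne_zero.2 (Ne.symm hs1)))
    · intro h
      have h' : v ∈ LinearMap.ker (R' p.2) := hker p.2 ▸ h
      rw [LinearMap.mem_ker] at h h' ⊢
      simp [Q, h, h']
  have hQe : ∀ p, Nonempty ((f p.2).carrier ≃ₗ[ℝ] LinearMap.range (Q p)) := fun p =>
    ⟨(LinearEquiv.ofEq _ _ (hf p.2)).trans ((R p.2).quotKerEquivRange.symm.trans
      ((Submodule.quotEquivOfEq _ _ (hQker p).symm).trans (Q p).quotKerEquivRange))⟩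
  let g : unitInterval × Z → BO n := fun p =>
    { carrier := LinearMap.range (Q p)
      finite := by
        have := (f p.2).finite
        exact Module.Finite.equiv (hQe p).some
      finrank_eq := by
        rw [← (hQe p).some.finrank_eq, (f p.2).finrank_eq] }
  refine ⟨⟨⟨g, hQc.continuous_of_range fun p => rfl⟩, fun z => BO.ext ?_, fun z => BO.ext ?_⟩⟩
  · change LinearMap.range (Q (0, z)) = (f z).carrier
    rw [hf]
    congr 1
    simp [Q]
  · change LinearMap.range (Q (1, z)) = (f' z).carrier
    rw [hf']
    congr 1
    simp [Q]

end

/-! ### Gram–Schmidt orthogonalization with cut-offs -/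

section

variable {Z V : Type*} [NormedAddCommGroup V]

/-- A positive lower bound of `‖g‖` on `S`; the junk value is `1` if there is none. -/
noncomputable def normLowerBound (S : Set Z) (g : Z → V) : ℝ :=
  open Classical in if h : ∃ ε > 0, ∀ z ∈ S, ε ≤ ‖g z‖ then h.choose else 1

theorem normLowerBound_pos (S : Set Z) (g : Z → V) : 0 < normLowerBound S g := by
  unfold normLowerBound
  split_ifs with h
  · exact h.choose_spec.1
  · exact one_pos

theorem normLowerBound_le [TopologicalSpace Z] {S : Set Z} (hS : IsCompact S) {g : Z → V}
    (hg : Continuous g) (h0 : ∀ z ∈ S, g z ≠ 0) {z : Z} (hz : z ∈ S) :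
    normLowerBound S g ≤ ‖g z‖ := by
  have h : ∃ ε > 0, ∀ z ∈ S, ε ≤ ‖g z‖ := by
    obtain ⟨y, hy, hmin⟩ := hS.exists_isMinOn ⟨z, hz⟩ hg.norm.continuousOn
    exact ⟨‖g y‖, norm_pos_iff.2 (h0 y hy), fun x hx => hmin hx⟩
  unfold normLowerBound
  rw [dif_pos h]
  exact h.choose_spec.2 z hz

variable [InnerProductSpace ℝ V]

/-- Gram–Schmidt orthogonalization of a sequence of families `s t : Z → V` of vectors, in which the
`t`-th orthogonalized vector `g` is divided by `max ‖g‖ ε` in place of `‖g‖`, where `ε` is a lower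
bound of `‖g‖` on the given set `S t`. So the result is defined and continuous everywhere, and it is
a unit vector on `S t`. -/
noncomputable def cutoffGramSchmidt (S : ℕ → Set Z) (s : ℕ → Z → V) (t : ℕ) : Z → V :=
  let g : Z → V := fun z => s t z -
    ∑ r : Fin t, inner ℝ (cutoffGramSchmidt S s r z) (s t z) • cutoffGramSchmidt S s r z
  fun z => (max ‖g z‖ (normLowerBound (S t) g))⁻¹ • g z
termination_by t
decreasing_by all_goals exact r.2

/-- The component of `s t` orthogonal to the earlier vectors, before its normalization. -/
noncomputable def cutoffResidual (S : ℕ → Set Z) (s : ℕ → Z → V) (t : ℕ) (z : Z) : V :=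
  s t z - ∑ r : Fin t, inner ℝ (cutoffGramSchmidt S s r z) (s t z) • cutoffGramSchmidt S s r z

variable {S : ℕ → Set Z} {s : ℕ → Z → V}

theorem cutoffGramSchmidt_eq (t : ℕ) (z : Z) : cutoffGramSchmidt S s t z =
    (max ‖cutoffResidual S s t z‖ (normLowerBound (S t) (cutoffResidual S s t)))⁻¹ •
      cutoffResidual S s t z := by
  rw [cutoffGramSchmidt]
  rfl

theorem cutoffGramSchmidt_mem_span (t : ℕ) (z : Z) :
    cutoffGramSchmidt S s t z ∈ Submodule.span ℝ ((fun r => s r z) '' Set.Iic t) := by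
  induction t using Nat.strong_induction_on with
  | _ t ih =>
    rw [cutoffGramSchmidt_eq]
    refine Submodule.smul_mem _ _ (Submodule.sub_mem _
      (Submodule.subset_span ⟨t, Set.mem_Iic.2 le_rfl, rfl⟩) (Submodule.sum_mem _ fun r _ =>
        Submodule.smul_mem _ _ (Submodule.span_mono (Set.image_mono ?_) (ih r r.2))))
    exact Set.Iic_subset_Iic.2 r.2.le

theorem cutoffResidual_ne_zero {t : ℕ} {z : Z}
    (h : LinearIndependent ℝ fun r : Fin (t + 1) => s r z) : cutoffResidual S s t z ≠ 0 := by
  intro h0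
  have hmem : s t z ∈ Submodule.span ℝ ((fun r => s r z) '' Set.Iio t) := by
    rw [sub_eq_zero.1 h0]
    refine Submodule.sum_mem _ fun r _ => Submodule.smul_mem _ _
      (Submodule.span_mono (Set.image_mono ?_) (cutoffGramSchmidt_mem_span _ z))
    exact fun x hx => lt_of_le_of_lt hx r.2
  refine h.notMem_span_image (s := {r | r.1 < t}) (x := Fin.last t) (by simp) ?_
  rw [Fin.val_last]
  convert hmem using 2
  ext v
  constructor
  · rintro ⟨r, hr, rfl⟩
    exact ⟨r, hr, rfl⟩
  · rintro ⟨r, hr, rfl⟩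
    exact ⟨⟨r, Nat.lt_succ_of_lt hr⟩, hr, rfl⟩

/-- The lower bounds are constants, so the orthogonalization commutes with isometries up to signs. -/
theorem cutoffGramSchmidt_equivariant (T : Z → Z) (τ : V →ₗᵢ[ℝ] V) (σ : ℕ → ℝ)
    (hσ : ∀ t, σ t * σ t = 1) (hT : ∀ t z, s t (T z) = σ t • τ (s t z)) (t : ℕ) (z : Z) :
    cutoffGramSchmidt S s t (T z) = σ t • τ (cutoffGramSchmidt S s t z) := by
  induction t using Nat.strong_induction_on with
  | _ t ih =>
    have hg : cutoffResidual S s t (T z) = σ t • τ (cutoffResidual S s t z) := by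
      rw [cutoffResidual, cutoffResidual, map_sub, map_sum, smul_sub, hT, Finset.smul_sum]
      congr 1
      refine Finset.sum_congr rfl fun r _ => ?_
      rw [ih r r.2, real_inner_smul_left, real_inner_smul_right, τ.inner_map_map, map_smul,
        smul_smul, smul_smul]
      congr 1
      linear_combination (σ t * inner ℝ (cutoffGramSchmidt S s r z) (s t z)) * hσ r
    have hn : ‖cutoffResidual S s t (T z)‖ = ‖cutoffResidual S s t z‖ := by
      have : |σ t| = 1 := by
        rcases mul_self_eq_one_iff.1 (hσ t) with h | h <;> simp [h]
      rw [hg, norm_smul, τ.norm_map, Real.norm_eq_abs, this, one_mul]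
    rw [cutoffGramSchmidt_eq, cutoffGramSchmidt_eq, hn, hg, map_smul, smul_comm]

variable [TopologicalSpace Z]

theorem continuous_cutoffResidual_of (hs : ∀ t, Continuous (s t)) (t : ℕ)
    (h : ∀ r < t, Continuous (cutoffGramSchmidt S s r)) : Continuous (cutoffResidual S s t) :=
  (hs t).sub (continuous_finsetSum _ fun r _ =>
    ((h r r.2).inner (hs t)).smul (h r r.2))

theorem continuous_cutoffGramSchmidt (hs : ∀ t, Continuous (s t)) (t : ℕ) :
    Continuous (cutoffGramSchmidt S s t) := by
  induction t using Nat.strong_induction_on with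
  | _ t ih =>
    have hg := continuous_cutoffResidual_of hs t ih
    refine Continuous.congr ?_ fun z => (cutoffGramSchmidt_eq t z).symm
    exact ((hg.norm.max continuous_const).inv₀ fun z =>
      (lt_max_of_lt_right (normLowerBound_pos _ _)).ne').smul hg

theorem norm_cutoffGramSchmidt (hs : ∀ t, Continuous (s t)) {t : ℕ} (hS : IsCompact (S t))
    (hli : ∀ z ∈ S t, LinearIndependent ℝ fun r : Fin (t + 1) => s r z) {z : Z} (hz : z ∈ S t) :
    ‖cutoffGramSchmidt S s t z‖ = 1 := by
  have hg := continuous_cutoffResidual_of (S := S) hs t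
    fun r _ => continuous_cutoffGramSchmidt hs r
  rw [cutoffGramSchmidt_eq, max_eq_left (normLowerBound_le hS hg
    (fun z hz => cutoffResidual_ne_zero (hli z hz)) hz), norm_smul, norm_inv, norm_norm]
  exact inv_mul_cancel₀ (norm_ne_zero_iff.2 (cutoffResidual_ne_zero (hli z hz)))

/-- On `S r`, the `r`-th vector is orthogonal to all the others, those that are not normalized
included. -/
theorem inner_cutoffGramSchmidt_of_lt (hs : ∀ t, Continuous (s t)) (hS : ∀ t, IsCompact (S t))
    (hSa : ∀ r t, r ≤ t → S t ⊆ S r)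
    (hli : ∀ t, ∀ z ∈ S t, LinearIndependent ℝ fun r : Fin (t + 1) => s r z) {r t : ℕ}
    (hrt : r < t) {z : Z} (hz : z ∈ S r) :
    inner ℝ (cutoffGramSchmidt S s r z) (cutoffGramSchmidt S s t z) = 0 := by
  induction t using Nat.strong_induction_on generalizing r with
  | _ t ih =>
    suffices h : inner ℝ (cutoffGramSchmidt S s r z) (cutoffResidual S s t z) = 0 by
      rw [cutoffGramSchmidt_eq t, inner_smul_right, h, mul_zero]
    rw [cutoffResidual, inner_sub_right, inner_sum, Finset.sum_eq_single (⟨r, hrt⟩ : Fin t)]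
    · rw [inner_smul_right, real_inner_self_eq_norm_sq,
        norm_cutoffGramSchmidt hs (hS r) (hli r) hz]
      simp
    · intro q _ hq
      rw [inner_smul_right]
      rcases lt_or_gt_of_ne (fun h => hq (Fin.ext h) : q.1 ≠ r) with h | h
      · rw [real_inner_comm (cutoffGramSchmidt S s q z), ih r hrt h (hSa _ _ h.le hz), mul_zero]
      · rw [ih q q.2 h hz, mul_zero]
    · simp

theorem inner_cutoffGramSchmidt (hs : ∀ t, Continuous (s t)) (hS : ∀ t, IsCompact (S t))
    (hSa : ∀ r t, r ≤ t → S t ⊆ S r)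
    (hli : ∀ t, ∀ z ∈ S t, LinearIndependent ℝ fun r : Fin (t + 1) => s r z) (r t : ℕ)
    {z : Z} (hz : z ∈ S r) :
    inner ℝ (cutoffGramSchmidt S s t z) (cutoffGramSchmidt S s r z) = if t = r then 1 else 0 := by
  split_ifs with h
  · rw [h, real_inner_self_eq_norm_sq, norm_cutoffGramSchmidt hs (hS r) (hli r) hz, one_pow]
  · rcases lt_or_gt_of_ne h with h | h
    · exact inner_cutoffGramSchmidt_of_lt hs hS hSa hli h (hSa _ _ h.le hz)
    · rw [real_inner_comm]
      exact inner_cutoffGramSchmidt_of_lt hs hS hSa hli h hz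

end

/-! ### Two-point Hermite interpolation -/

open Polynomial in
/-- A polynomial of degree less than `n ≤ a + b` is determined by its first `a` Taylor
coefficients at `1` and its first `b` Taylor coefficients at `-1`. -/
theorem eq_zero_of_taylor_eq_zero {n a b : ℕ} (hn : n ≤ a + b) (l : ℕ → ℝ)
    (ha : ∀ p < a, ∑ t ∈ Finset.range n, l t * (t.choose p : ℝ) = 0)
    (hb : ∀ p < b, ∑ t ∈ Finset.range n, l t * ((-1) ^ t * (t.choose p : ℝ)) = 0) :
    ∀ t < n, l t = 0 := by
  have key : ∀ (m : ℕ → ℝ) (c : ℕ),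
      (∀ p < c, ∑ t ∈ Finset.range n, m t * (t.choose p : ℝ) = 0) →
      (X - C 1) ^ c ∣ ∑ t ∈ Finset.range n, C (m t) * X ^ t := by
    intro m c h
    rw [X_sub_C_pow_dvd_iff, X_pow_dvd_iff]
    intro p hp
    rw [← h p hp]
    simp only [Polynomial.sum_comp, Polynomial.mul_comp, C_comp, X_pow_comp, finsetSum_coeff,
      coeff_C_mul, C_1, coeff_X_add_one_pow]
  have h1 := key l a ha
  have h2 := key (fun t => l t * (-1) ^ t) b (fun p hp => by
    rw [← hb p hp]
    exact Finset.sum_congr rfl fun t _ => by ring)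
  set f : ℝ[X] := ∑ t ∈ Finset.range n, C (l t) * X ^ t with hf
  have h3 : (X - C (-1)) ^ b ∣ f := by
    obtain ⟨u, hu⟩ := h2
    have := congrArg (fun P : ℝ[X] => P.comp (-X)) hu
    -- The substitution of `-X` for `X` moves the point `1` to `-1`.
    have hneg : ((X - C (1 : ℝ)) ^ b).comp (-X) = (-1) ^ b * (X - C (-1)) ^ b := by
      rw [pow_comp, ← mul_pow]
      congr 1
      simp only [sub_comp, X_comp, map_neg, C_1, one_comp]
      ring
    have hf' : (∑ t ∈ Finset.range n, C (l t * (-1) ^ t) * X ^ t : ℝ[X]).comp (-X) = f := by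
      rw [hf, Polynomial.sum_comp]
      refine Finset.sum_congr rfl fun t _ => ?_
      rw [Polynomial.mul_comp, C_comp, X_pow_comp, C_mul, C_pow, map_neg, C_1, neg_pow (X : ℝ[X])]
      have : ((-1 : ℝ[X]) ^ t) * (-1) ^ t = 1 := by rw [← mul_pow]; simp
      linear_combination (C (l t) * X ^ t) * this
    refine ⟨(-1) ^ b * u.comp (-X), ?_⟩
    rw [← hf']
    refine this.trans ?_
    rw [Polynomial.mul_comp, hneg]
    ring
  have hco : IsCoprime ((X - C (1 : ℝ)) ^ a) ((X - C (-1 : ℝ)) ^ b) :=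
    (isCoprime_X_sub_C_of_isUnit_sub (by norm_num)).pow
  have h4 := hco.mul_dvd h1 h3
  have hdeg : f.degree < n := by
    refine (degree_sum_le _ _).trans_lt ((Finset.sup_lt_iff (WithBot.bot_lt_coe n)).2 fun t ht => ?_)
    exact (degree_C_mul_X_pow_le _ _).trans_lt (Nat.cast_lt.2 (Finset.mem_range.1 ht))
  have h0 : f = 0 := by
    refine eq_zero_of_dvd_of_degree_lt h4 (hdeg.trans_le ?_)
    rw [degree_mul, degree_pow, degree_pow, degree_X_sub_C, degree_X_sub_C]
    simp only [nsmul_eq_mul, mul_one]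
    exact_mod_cast hn
  intro t ht
  have := congrArg (fun P : ℝ[X] => P.coeff t) h0
  simpa [hf, finsetSum_coeff, coeff_X_pow, ht] using this

/-! ### Truncation of a compatible system of liftings -/

section

variable {V : Type*} [NormedAddCommGroup V] [InnerProductSpace ℝ V]

theorem continuousAt_gramSchmidt {Z : Type*} [TopologicalSpace Z] {D : ℕ} {m : Z → Fin D → V}
    {z₀ : Z} (hm : ∀ i, ContinuousAt (fun z => m z i) z₀) (hli : LinearIndependent ℝ (m z₀))
    (i : Fin D) : ContinuousAt (fun z => InnerProductSpace.gramSchmidt ℝ (m z) i) z₀ := by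
  induction i using WellFoundedLT.induction with
  | _ i ih =>
    have h : ∀ z, InnerProductSpace.gramSchmidt ℝ (m z) i = m z i - ∑ j ∈ Finset.Iio i,
        (inner ℝ (InnerProductSpace.gramSchmidt ℝ (m z) j) (m z i) /
          ‖InnerProductSpace.gramSchmidt ℝ (m z) j‖ ^ 2) •
          InnerProductSpace.gramSchmidt ℝ (m z) j := fun z =>
      eq_sub_of_add_eq (InnerProductSpace.gramSchmidt_def'' ℝ (m z) i).symm
    simp only [h]
    refine (hm i).sub (tendsto_finsetSum _ fun j hj => ?_)
    have hj' := ih j (Finset.mem_Iio.1 hj)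
    refine Filter.Tendsto.smul (ContinuousAt.div (hj'.inner (hm i)) (hj'.norm.pow 2) ?_) hj'
    exact pow_ne_zero 2 (norm_ne_zero_iff.2 (InnerProductSpace.gramSchmidt_ne_zero j hli))

/-- The orthogonal projection onto a subspace depends continuously on a frame of the subspace. -/
theorem continuousAt_starProjection {Z : Type*} [TopologicalSpace Z] [FiniteDimensional ℝ V]
    {D : ℕ} {m : Z → Fin D → V} {W : Z → Submodule ℝ V} {z₀ : Z}
    (hm : ∀ i, ContinuousAt (fun z => m z i) z₀) (hli : LinearIndependent ℝ (m z₀))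
    (hW : ∀ᶠ z in 𝓝 z₀, W z = Submodule.span ℝ (Set.range (m z))) (v : V) :
    ContinuousAt (fun z => (W z).starProjection v) z₀ := by
  have hgs := continuousAt_gramSchmidt hm hli
  have h : ContinuousAt (fun z => ∑ i : Fin D,
      (inner ℝ (InnerProductSpace.gramSchmidt ℝ (m z) i) v /
        ‖InnerProductSpace.gramSchmidt ℝ (m z) i‖ ^ 2) •
        InnerProductSpace.gramSchmidt ℝ (m z) i) z₀ := by
    refine tendsto_finsetSum _ fun j _ => ?_
    refine Filter.Tendsto.smul (ContinuousAt.div ((hgs j).inner continuousAt_const)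
      ((hgs j).norm.pow 2) ?_) (hgs j)
    exact pow_ne_zero 2 (norm_ne_zero_iff.2 (InnerProductSpace.gramSchmidt_ne_zero j hli))
  refine h.congr ?_
  filter_upwards [hW] with z hz
  rw [hz, ← InnerProductSpace.span_gramSchmidt ℝ (m z)]
  set g := InnerProductSpace.gramSchmidt ℝ (m z) with hg
  symm
  refine Submodule.eq_starProjection_of_mem_of_inner_eq_zero
    (Submodule.sum_mem _ fun i _ => Submodule.smul_mem _ _ (Submodule.subset_span ⟨i, rfl⟩)) ?_
  intro w hw
  induction hw using Submodule.span_induction with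
  | mem w hw =>
    obtain ⟨j, rfl⟩ := hw
    rw [inner_sub_left, sum_inner, Finset.sum_eq_single j]
    · rw [real_inner_smul_left, real_inner_self_eq_norm_sq, real_inner_comm v]
      by_cases h0 : ‖g j‖ = 0
      · rw [norm_eq_zero] at h0
        simp [h0]
      · field_simp
        ring
    · intro i _ hij
      rw [real_inner_smul_left, InnerProductSpace.gramSchmidt_orthogonal ℝ (m z) hij, mul_zero]
    · simp
  | zero => simp
  | add x y _ _ hx hy => rw [inner_add_right, hx, hy, add_zero]
  | smul a x _ hx => rw [inner_smul_right, hx, mul_zero]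

end

section

variable {B : Type*} [TopologicalSpace B] {F : Type*} [NormedAddCommGroup F]
  [NormedSpace ℝ F] {E : B → Type*} [∀ x, AddCommMonoid (E x)] [∀ x, Module ℝ (E x)]
  [TopologicalSpace (TotalSpace F E)]

/-- Near a point of a subset `A` of the base, the images of a local frame of a vector bundle form
a frame of the image of a map `ψ` of the restriction to `A`. -/
theorem exists_local_frame [FiniteDimensional ℝ F] [∀ x, TopologicalSpace (E x)] [FiberBundle F E]
    [VectorBundle ℝ F E] {A : Set B} {V : Type*} [TopologicalSpace V] [AddCommGroup V] [Module ℝ V]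
    (ψ : ∀ x : A, E x →ₗ[ℝ] V)
    (hψ : Continuous fun p : {p : TotalSpace F E // p.proj ∈ A} => ψ ⟨p.1.proj, p.2⟩ p.1.2)
    (x₀ : A) : ∃ m : A → Fin (Module.finrank ℝ F) → V, (∀ i, ContinuousAt (fun x => m x i) x₀) ∧
      ∀ᶠ x in 𝓝 x₀, LinearMap.range (ψ x) = Submodule.span ℝ (Set.range (m x)) ∧
        (Function.Injective (ψ x) ↔ LinearIndependent ℝ (m x)) := by
  let e := trivializationAt F E x₀.1
  let b := Module.finBasis ℝ F
  refine ⟨fun x i => ψ x (e.symm x (b i)), fun i => ?_, ?_⟩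
  · refine hψ.continuousAt.comp (f := fun x : A =>
      (⟨⟨x.1, e.symm x.1 (b i)⟩, x.2⟩ : {p : TotalSpace F E // p.proj ∈ A})) ?_
    refine Topology.IsInducing.subtypeVal.continuousAt_iff.2 ?_
    have h : ContinuousAt (fun z : B × F => TotalSpace.mk' F z.1 (e.symm z.1 z.2)) (x₀.1, b i) :=
      e.continuousOn_symm.continuousAt
        ((e.open_baseSet.prod isOpen_univ).mem_nhds
          ⟨FiberBundle.mem_baseSet_trivializationAt' x₀.1, Set.mem_univ _⟩)
    exact h.comp (f := fun x : A => (x.1, b i))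
      (continuous_subtype_val.prodMk continuous_const).continuousAt
  · have hU : ∀ᶠ x : A in 𝓝 x₀, x.1 ∈ e.baseSet :=
      continuous_subtype_val.continuousAt.eventually_mem
        (e.open_baseSet.mem_nhds (FiberBundle.mem_baseSet_trivializationAt' x₀.1))
    filter_upwards [hU] with x hx
    let b' := b.map (e.linearEquivAt ℝ x.1 hx).symm
    have hb' : (fun i => ψ x (e.symm x.1 (b i))) = ψ x ∘ b' := by
      funext i
      simp only [b', Function.comp_apply, Module.Basis.map_apply,
        Trivialization.linearEquivAt_symm_apply]
    rw [hb']
    constructor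
    · rw [LinearMap.range_eq_map, ← b'.span_eq, Submodule.map_span, Set.range_comp]
    · have h : ⇑(Finsupp.linearCombination ℝ (ψ x ∘ b')) = ψ x ∘ b'.repr.symm := by
        funext c
        rw [Function.comp_apply, Module.Basis.repr_symm_apply, Finsupp.apply_linearCombination]
      rw [LinearIndependent, h]
      exact (EquivLike.injective_comp b'.repr.symm (ψ x)).symm

/-- Over `A i`, the first `dim F - d i` standard basis vectors of `ℝ^∞` lie in the fibres of the
pullback of the tautological bundle. -/
theorem CompatLift.single_mem {k : ℕ} {A : ℕ → Set B} {d : ℕ → ℕ} (L : CompatLift F E k A d)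
    (hA : ∀ i < k, A i ⊆ A (i + 1)) {i : ℕ} (hi : i ≤ k) (x : A k) (hx : x.1 ∈ A i) {q : ℕ}
    (hq : q < Module.finrank ℝ F - d i) :
    Finsupp.single q 1 ∈ (BO.incl L.le_dim (L.map k x)).carrier := by
  have hle : ∀ j, i ≤ j → j ≤ k → d j ≤ d k := fun j _ hj =>
    Nat.decreasingInduction' (P := fun j => d j ≤ d k)
      (fun n hn _ ih => (L.le_succ n hn).trans ih) hj le_rfl
  have key : ∀ j, i ≤ j → j ≤ k → ∃ h : x.1 ∈ A j,
      Finsupp.single q 1 ∈ (L.map j ⟨x.1, h⟩).carrier.comap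
        (RInf.drop (Module.finrank ℝ F - d j)) := by
    intro j hij
    induction j, hij using Nat.le_induction with
    | base =>
      intro _
      refine ⟨hx, ?_⟩
      have h0 : RInf.drop (Module.finrank ℝ F - d i) (Finsupp.single q 1) = 0 := by
        ext r
        rw [RInf.drop_apply, Finsupp.single_apply, if_neg (by omega), Finsupp.zero_apply]
      rw [Submodule.mem_comap, h0]
      exact zero_mem _
    | succ j hij ih =>
      intro hj
      obtain ⟨h, hm⟩ := ih (by omega)
      refine ⟨hA j hj h, ?_⟩
      rw [L.comm j hj x.1 h]
      change RInf.drop (d (j + 1) - d j)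
        (RInf.drop (Module.finrank ℝ F - d (j + 1)) (Finsupp.single q 1)) ∈
          (L.map j ⟨x.1, h⟩).carrier
      have h1 := hle (j + 1) (by omega) hj
      have h2 := L.le_dim
      have h3 := L.le_succ j hj
      rw [RInf.drop_drop, show d (j + 1) - d j + (Module.finrank ℝ F - d (j + 1)) =
        Module.finrank ℝ F - d j by omega]
      exact Submodule.mem_comap.1 hm
  exact (key k hi le_rfl).2

/-- The first `N` coordinates of a vector of `ℝ^∞`. -/
noncomputable def RInf.trunc (N : ℕ) : RInf →ₗ[ℝ] EuclideanSpace ℝ (Fin N) :=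
  (WithLp.linearEquiv 2 ℝ (Fin N → ℝ)).symm.toLinearMap ∘ₗ
    LinearMap.pi fun q : Fin N => Finsupp.lapply (q : ℕ)

theorem RInf.trunc_apply (N : ℕ) (w : RInf) (q : Fin N) : RInf.trunc N w q = w q := rfl

theorem exists_trunc_injOn (W : Submodule ℝ RInf) [Module.Finite ℝ W] :
    ∃ N, Set.InjOn (RInf.trunc N) W := by
  obtain ⟨s, hs⟩ := Module.Finite.iff_fg.1 (inferInstance : Module.Finite ℝ W)
  let N := s.sup fun w => w.support.sup Nat.succ
  have hN : ∀ w ∈ W, ∀ q, N ≤ q → w q = 0 := by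
    intro w hw
    rw [← hs] at hw
    induction hw using Submodule.span_induction with
    | mem w hw =>
      intro q hq
      by_contra h
      have h1 : q.succ ≤ w.support.sup Nat.succ :=
        Finset.le_sup (f := Nat.succ) (Finsupp.mem_support_iff.2 h)
      have h2 : w.support.sup Nat.succ ≤ N :=
        Finset.le_sup (f := fun w : RInf => w.support.sup Nat.succ) hw
      omega
    | zero => simp
    | add x y _ _ hx hy =>
      intro q hq
      rw [Finsupp.add_apply, hx q hq, hy q hq, add_zero]
    | smul a x _ hx =>
      intro q hq
      rw [Finsupp.smul_apply, hx q hq, smul_zero]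
  refine ⟨N, fun w hw w' hw' h => Finsupp.ext fun q => ?_⟩
  by_cases hq : q < N
  · exact congrArg (fun v : EuclideanSpace ℝ (Fin N) => v ⟨q, hq⟩) h
  · rw [hN w hw q (not_lt.1 hq), hN w' hw' q (not_lt.1 hq)]

theorem trunc_injOn_mono {W : Set RInf} {N N' : ℕ} (h : N ≤ N')
    (hN : Set.InjOn (RInf.trunc N) W) : Set.InjOn (RInf.trunc N') W := fun w hw w' hw' heq =>
  hN hw hw' (by
    ext q
    exact congrArg (fun v : EuclideanSpace ℝ (Fin N') => v ⟨q, q.2.trans_le h⟩) heq)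

/-- A compatible system of liftings over a compact space gives an embedding of the bundle into a
trivial bundle of finite rank, such that over `A i` the image contains the first `dim F - d i`
standard basis vectors. -/
theorem CompatLift.exists_embedding [FiniteDimensional ℝ F] [∀ x, TopologicalSpace (E x)]
    [FiberBundle F E] [VectorBundle ℝ F E] {k : ℕ} {A : ℕ → Set B} {d : ℕ → ℕ}
    [CompactSpace (A k)] (L : CompatLift F E k A d) (hA : ∀ i < k, A i ⊆ A (i + 1)) :
    ∃ (N : ℕ) (ψ : ∀ x : A k, E x →ₗ[ℝ] EuclideanSpace ℝ (Fin N)),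
      Module.finrank ℝ F ≤ N ∧ (∀ x, Function.Injective (ψ x)) ∧
      (Continuous fun p : {p : TotalSpace F E // p.proj ∈ A k} => ψ ⟨p.1.proj, p.2⟩ p.1.2) ∧
      ∀ i ≤ k, ∀ x : A k, x.1 ∈ A i → ∀ q : Fin N, q < Module.finrank ℝ F - d i →
        EuclideanSpace.single q 1 ∈ LinearMap.range (ψ x) := by
  let φ : ∀ x : A k, E x →ₗ[ℝ] RInf := fun x =>
    (BO.incl L.le_dim (L.map k x)).carrier.subtype ∘ₗ (L.classify.fibre x).toLinearMap
  have hφr : ∀ x, (LinearMap.range (φ x)) = (BO.incl L.le_dim (L.map k x)).carrier := fun x => by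
    rw [LinearMap.range_comp, LinearEquiv.range, Submodule.map_top, Submodule.range_subtype]
  have hφi : ∀ x, Function.Injective (φ x) := fun x =>
    (Submodule.injective_subtype _).comp (L.classify.fibre x).injective
  have hcont : ∀ N, Continuous fun p : {p : TotalSpace F E // p.proj ∈ A k} =>
      (RInf.trunc N ∘ₗ φ ⟨p.1.proj, p.2⟩) p.1.2 := fun N => by
    refine (PiLp.continuous_toLp 2 _).comp (continuous_pi fun q => ?_)
    exact (RInf.continuous_apply q).comp (continuous_snd.comp L.classify.continuous_total)
  have hopen : ∀ N, IsOpen {x : A k | Function.Injective (RInf.trunc N ∘ₗ φ x)} := fun N => by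
    refine isOpen_iff_mem_nhds.2 fun x₀ hx₀ => ?_
    obtain ⟨m, hm, hev⟩ := exists_local_frame (F := F) (fun x => RInf.trunc N ∘ₗ φ x) (hcont N) x₀
    have hli := (hev.self_of_nhds.2.1 hx₀).eventually
    have hm' : ContinuousAt m x₀ := continuousAt_pi.2 hm
    filter_upwards [hev, hm'.eventually hli] with x h1 h2 using h1.2.2 h2
  have hinj : ∀ N x, Function.Injective (RInf.trunc N ∘ₗ φ x) ↔
      Set.InjOn (RInf.trunc N) (LinearMap.range (φ x)) := fun N x => by
    rw [LinearMap.coe_range]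
    refine ⟨fun h => Function.Injective.injOn_range h, fun h a b hab => hφi x ?_⟩
    exact h ⟨a, rfl⟩ ⟨b, rfl⟩ hab
  -- Injectivity of the truncation is open in `x` and monotone in `N`.
  obtain ⟨N, hN⟩ : ∃ N, ∀ x : A k, Function.Injective (RInf.trunc N ∘ₗ φ x) := by
    obtain ⟨N, hN⟩ := isCompact_univ.elim_directed_cover _ hopen (fun x _ => by
      have := (BO.incl L.le_dim (L.map k x)).finite
      obtain ⟨N, hN⟩ := exists_trunc_injOn (BO.incl L.le_dim (L.map k x)).carrier
      rw [← hφr] at hN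
      exact Set.mem_iUnion.2 ⟨N, (hinj N x).2 hN⟩)
      (directed_of_isDirected_le fun N N' h x hx =>
        (hinj N' x).2 (trunc_injOn_mono h ((hinj N x).1 hx)))
    exact ⟨N, fun x => hN (Set.mem_univ x)⟩
  -- At least `dim F` coordinates are kept, so that the basis vectors in question are not cut off.
  refine ⟨max N (Module.finrank ℝ F), fun x => RInf.trunc _ ∘ₗ φ x, le_max_right _ _, fun x =>
    (hinj _ x).2 (trunc_injOn_mono (le_max_left _ _) ((hinj N x).1 (hN x))), hcont _, ?_⟩
  intro i hi x hx q hq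
  have h := L.single_mem hA hi x hx hq
  rw [← hφr] at h
  obtain ⟨a, ha⟩ := h
  refine ⟨a, ?_⟩
  rw [LinearMap.comp_apply, ha]
  ext r
  rw [RInf.trunc_apply, Finsupp.single_apply, PiLp.single_apply]
  simp only [Fin.ext_iff, eq_comm]

end

/-! ### Building a compatible system of liftings from an embedding -/

theorem RInf.drop_single (m q : ℕ) (a : ℝ) :
    RInf.drop m (Finsupp.single (q + m) a) = Finsupp.single q a := by
  ext r
  rw [RInf.drop_apply, Finsupp.single_apply, Finsupp.single_apply]
  simp only [Nat.add_right_cancel_iff]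

theorem RInf.comap_drop_map_drop {c : ℕ} {W : Submodule ℝ RInf}
    (h : ∀ q < c, Finsupp.single q 1 ∈ W) : (W.map (RInf.drop c)).comap (RInf.drop c) = W := by
  refine le_antisymm ?_ (Submodule.le_comap_map _ _)
  rw [Submodule.comap_map_eq, sup_le_iff]
  refine ⟨le_rfl, fun w hw => ?_⟩
  rw [← Finsupp.sum_single w]
  refine Submodule.sum_mem _ fun q hq => ?_
  have hqc : q < c := by
    by_contra hqc
    have h0 := DFunLike.congr_fun (LinearMap.mem_ker.1 hw) (q - c)
    rw [RInf.drop_apply, Nat.sub_add_cancel (not_lt.1 hqc)] at h0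
    exact Finsupp.mem_support_iff.1 hq h0
  have := W.smul_mem (w q) (h q hqc)
  rwa [Finsupp.smul_single, smul_eq_mul, mul_one] at this

theorem RInf.comap_drop_map_drop_add {l m : ℕ} {W : Submodule ℝ RInf}
    (h : ∀ q < l + m, Finsupp.single q 1 ∈ W) :
    (W.map (RInf.drop (l + m))).comap (RInf.drop l) = W.map (RInf.drop m) := by
  have h1 : W.map (RInf.drop (l + m)) = (W.map (RInf.drop m)).map (RInf.drop l) := by
    rw [← Submodule.map_comp]
    congr 1
    exact LinearMap.ext fun w => (RInf.drop_drop l m w).symm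
  rw [h1]
  refine RInf.comap_drop_map_drop fun q hq => ?_
  rw [← RInf.drop_single m]
  exact Submodule.mem_map_of_mem (h _ (by omega))

section

variable {B : Type*} [TopologicalSpace B] {F : Type*} [NormedAddCommGroup F]
  [NormedSpace ℝ F] {E : B → Type*} [∀ x, AddCommMonoid (E x)] [∀ x, Module ℝ (E x)]
  [TopologicalSpace (TotalSpace F E)]

/-- A fibrewise embedding `ψ` of `E|_{A k}` into `ℝ^∞` whose image contains, over `A i`, the first
`dim F - d i` standard basis vectors gives a compatible system of liftings: the image of `ψ` over
`x ∈ A i` is `ℝ^(dim F - d i) ⊕ f_i x`. The continuity of the image is expressed by a family `R`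
of linear maps with the same images and a constant source. -/
theorem CompatLift.exists_of_embedding {k : ℕ} {A : ℕ → Set B} {d : ℕ → ℕ}
    (hproj : Continuous (TotalSpace.proj : TotalSpace F E → B))
    (hE : ∀ x : A k, Nonempty (E x ≃ₗ[ℝ] F))
    (hA : ∀ i ≤ k, A i ⊆ A k) (hd : ∀ i < k, d i ≤ d (i + 1))
    (hdk : ∀ i ≤ k, d i ≤ Module.finrank ℝ F)
    (ψ : ∀ x : A k, E x →ₗ[ℝ] RInf) (hψi : ∀ x, Function.Injective (ψ x))
    (hψc : ∀ q, Continuous fun p : {p : TotalSpace F E // p.proj ∈ A k} =>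
      ψ ⟨p.1.proj, p.2⟩ p.1.2 q)
    {V : Type*} [AddCommGroup V] [Module ℝ V] [Module.Finite ℝ V]
    (R : A k → V →ₗ[ℝ] RInf) (hR : IsContFamily R)
    (hRψ : ∀ x, LinearMap.range (R x) = LinearMap.range (ψ x))
    (hsingle : ∀ i ≤ k, ∀ x : A k, x.1 ∈ A i → ∀ q < Module.finrank ℝ F - d i,
      Finsupp.single q 1 ∈ LinearMap.range (ψ x)) :
    ∃ L : CompatLift F E k A d,
      (∀ (i : ℕ) (hi : i ≤ k) (x : B) (hx : x ∈ A i), (L.map i ⟨x, hx⟩).carrier =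
        LinearMap.range (RInf.drop (Module.finrank ℝ F - d i) ∘ₗ R ⟨x, hA i hi hx⟩)) ∧
      ∀ x v, (L.classify.fibre x v : RInf) = ψ x v := by
  have hfin : ∀ x c, Module.Finite ℝ (LinearMap.range (RInf.drop c ∘ₗ R x)) := fun x c =>
    inferInstance
  have hrank : ∀ i ≤ k, ∀ x : A k, x.1 ∈ A i → Module.finrank ℝ
      (LinearMap.range (RInf.drop (Module.finrank ℝ F - d i) ∘ₗ R x)) = d i := by
    intro i hi x hx
    have h1 := (stabEquiv (Module.finrank ℝ F - d i)
      ((LinearMap.range (ψ x)).map (RInf.drop (Module.finrank ℝ F - d i)))).finrank_eq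
    have h2 := ((LinearEquiv.ofInjective (ψ x) (hψi x)).symm.trans (hE x).some).finrank_eq
    have := hfin x (Module.finrank ℝ F - d i)
    rw [LinearMap.range_comp, hRψ] at this ⊢
    have : Module.Free ℝ ((LinearMap.range (ψ x)).map (RInf.drop (Module.finrank ℝ F - d i))) :=
      Module.Free.of_divisionRing ℝ
        ((LinearMap.range (ψ x)).map (RInf.drop (Module.finrank ℝ F - d i)))
    rw [RInf.comap_drop_map_drop (hsingle i hi x hx), h2, Module.finrank_prod,
      Module.finrank_fin_fun] at h1
    have := hdk i hi
    omega
  let f : ∀ i, i ≤ k → C(A i, BO (d i)) := fun i hi =>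
    { toFun := fun x =>
        { carrier := LinearMap.range (RInf.drop (Module.finrank ℝ F - d i) ∘ₗ
            R ⟨x.1, hA i hi x.2⟩)
          finite := hfin _ _
          finrank_eq := hrank i hi ⟨x.1, hA i hi x.2⟩ x.2 }
      continuous_toFun := ((hR.drop _).comp
        (continuous_subtype_val.subtype_mk fun x : A i => hA i hi x.2)).continuous_of_range
          fun x => rfl }
  -- The indices `i > k` play no role, and any map will do there.
  let mp : ∀ i, C(A i, BO (d i)) := fun i =>
    if hi : i ≤ k then f i hi else ContinuousMap.const _ (Classical.arbitrary _)
  have hmp : ∀ (i : ℕ) (hi : i ≤ k) (x : B) (hx : x ∈ A i), (mp i ⟨x, hx⟩).carrier =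
      LinearMap.range (RInf.drop (Module.finrank ℝ F - d i) ∘ₗ R ⟨x, hA i hi hx⟩) :=
    fun i hi x hx => by simp only [mp, dif_pos hi]; rfl
  have hinc : ∀ x : A k, (BO.incl (hdk k le_rfl) (mp k x)).carrier = LinearMap.range (ψ x) := by
    intro x
    change (mp k ⟨x.1, x.2⟩).carrier.comap _ = _
    rw [hmp k le_rfl, LinearMap.range_comp, hRψ,
      RInf.comap_drop_map_drop (hsingle k le_rfl x x.2)]
  obtain ⟨⟨K, hK⟩, -⟩ := id hR
  have hψK : ∀ x v q, K ≤ q → ψ x v q = 0 := by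
    intro x v q hq
    obtain ⟨w, hw⟩ := (hRψ x).ge ⟨v, rfl⟩
    rw [← hw, hK x w q hq]
  refine ⟨{
    le_succ := hd
    le_dim := hdk k le_rfl
    map := mp
    comm := fun i hi x hx hx' => ?_
    classify :=
      { fibre := fun x => (LinearEquiv.ofInjective (ψ x) (hψi x)).trans
          (LinearEquiv.ofEq _ _ (hinc x).symm)
        continuous_total := ?_ } }, hmp, fun x v => rfl⟩
  · refine BO.ext ?_
    change _ = (mp i ⟨x, hx⟩).carrier.comap _
    rw [hmp _ hi, hmp _ hi.le, LinearMap.range_comp, LinearMap.range_comp, hRψ]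
    have h1 := hd i hi
    have h2 := hdk (i + 1) hi
    have h3 : Module.finrank ℝ F - d i =
      (d (i + 1) - d i) + (Module.finrank ℝ F - d (i + 1)) := by omega
    rw [h3]
    refine (RInf.comap_drop_map_drop_add ?_).symm
    rw [← h3]
    exact hsingle i hi.le _ hx
  · refine Continuous.prodMk ?_ ?_
    · refine Continuous.comp (g := fun x : A k => BO.incl (hdk k le_rfl) (mp k x)) ?_
        ((hproj.comp continuous_subtype_val).subtype_mk _)
      exact hR.continuous_of_range fun x => (hinc x).trans (hRψ x).symm
    · refine ((RInf.continuous_ofFin K).comp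
        (continuous_pi fun q : Fin K => hψc q)).congr fun p => ?_
      exact RInf.ofFin_trunc (hψK _ _)

end

/-! ### Splitting off an orthonormal system -/

section

variable (M : ℕ) {V : Type*} [NormedAddCommGroup V] [InnerProductSpace ℝ V]

/-- An embedding of `ℝ^M × V` into `ℝ^∞` that is the standard inclusion on `ℝ^M`. -/
noncomputable def encode (M : ℕ) (V : Type*) [NormedAddCommGroup V] [InnerProductSpace ℝ V]
    [FiniteDimensional ℝ V] : (Fin M → ℝ) × V →ₗ[ℝ] RInf :=
  RInf.ofFin M ∘ₗ LinearMap.fst ℝ _ _ +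
    Finsupp.lmapDomain ℝ ℝ (fun q : ℕ => q + M) ∘ₗ RInf.ofFin (Module.finrank ℝ V) ∘ₗ
      (Module.finBasis ℝ V).equivFun.toLinearMap ∘ₗ LinearMap.snd ℝ _ _

variable [FiniteDimensional ℝ V]

theorem encode_of_lt (p : (Fin M → ℝ) × V) (q : Fin M) : encode M V p q = p.1 q := by
  have h : Finsupp.mapDomain (fun q : ℕ => q + M) (RInf.ofFin (Module.finrank ℝ V)
      ((Module.finBasis ℝ V).equivFun p.2)) q = 0 :=
    Finsupp.mapDomain_of_notMem_range _ _ (by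
      rintro ⟨r, hr⟩
      have := q.2
      simp only at hr
      omega)
  have : encode M V p q = RInf.ofFin M p.1 q + Finsupp.mapDomain (fun q : ℕ => q + M)
    (RInf.ofFin (Module.finrank ℝ V) ((Module.finBasis ℝ V).equivFun p.2)) q := rfl
  rw [this, h, RInf.ofFin_apply_of_lt, add_zero]

theorem encode_add (p : (Fin M → ℝ) × V) (q : ℕ) : encode M V p (q + M) =
    RInf.ofFin (Module.finrank ℝ V) ((Module.finBasis ℝ V).equivFun p.2) q := by
  have : encode M V p (q + M) = RInf.ofFin M p.1 (q + M) + Finsupp.mapDomain (fun q : ℕ => q + M)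
    (RInf.ofFin (Module.finrank ℝ V) ((Module.finBasis ℝ V).equivFun p.2)) (q + M) := rfl
  rw [this, RInf.ofFin_apply_of_le _ _ _ (by omega), zero_add]
  exact Finsupp.mapDomain_apply (add_left_injective M) _ _

theorem encode_of_le (p : (Fin M → ℝ) × V) (q : ℕ) (hq : Module.finrank ℝ V + M ≤ q) :
    encode M V p q = 0 := by
  obtain ⟨r, rfl⟩ : ∃ r, q = r + M := ⟨q - M, by omega⟩
  rw [encode_add, RInf.ofFin_apply_of_le _ _ _ (by omega)]

theorem drop_encode_eq_zero_iff {c : ℕ} (hc : c ≤ M) (p : (Fin M → ℝ) × V) :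
    RInf.drop c (encode M V p) = 0 ↔ (∀ q : Fin M, c ≤ q → p.1 q = 0) ∧ p.2 = 0 := by
  constructor
  · intro h
    have h' : ∀ q, c ≤ q → encode M V p q = 0 := fun q hq => by
      have := DFunLike.congr_fun h (q - c)
      rwa [RInf.drop_apply, Nat.sub_add_cancel hq] at this
    refine ⟨fun q hq => by rw [← encode_of_lt, h' q hq], ?_⟩
    refine (LinearEquiv.map_eq_zero_iff (Module.finBasis ℝ V).equivFun).1
      (RInf.ofFin_injective _ ?_)
    rw [map_zero]
    ext q
    rw [← encode_add, h' _ (by omega), Finsupp.zero_apply]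
  · rintro ⟨h1, h2⟩
    ext q
    rw [RInf.drop_apply, Finsupp.zero_apply]
    by_cases hq : q + c < M
    · exact (encode_of_lt M p ⟨q + c, hq⟩).trans (h1 ⟨q + c, hq⟩ (Nat.le_add_left _ _))
    · obtain ⟨r, hr⟩ : ∃ r, q + c = r + M := ⟨q + c - M, by omega⟩
      rw [hr, encode_add, h2, map_zero, map_zero, Finsupp.zero_apply]

theorem encode_injective : Function.Injective (encode M V) := by
  rw [injective_iff_map_eq_zero]
  intro p hp
  have h := (drop_encode_eq_zero_iff M (Nat.zero_le M) p).1 (by rw [hp, map_zero])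
  exact Prod.ext (funext fun q => h.1 q (Nat.zero_le _)) h.2

theorem encode_single (q : Fin M) :
    encode M V (Pi.single q 1, 0) = Finsupp.single (q : ℕ) 1 := by
  ext r
  by_cases hr : r < M
  · refine (encode_of_lt M _ ⟨r, hr⟩).trans ?_
    change (Pi.single q 1 : Fin M → ℝ) ⟨r, hr⟩ = _
    rw [Pi.single_apply, Finsupp.single_apply]
    simp only [Fin.ext_iff, eq_comm]
  · obtain ⟨t, rfl⟩ : ∃ t, r = t + M := ⟨r - M, by omega⟩
    have := q.2
    rw [encode_add, map_zero, map_zero, Finsupp.single_apply, if_neg (by omega),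
      Finsupp.zero_apply]

theorem continuous_encode_apply (q : ℕ) : Continuous fun p : (Fin M → ℝ) × V => encode M V p q :=
  (Finsupp.lapply q ∘ₗ encode M V).continuous_of_finiteDimensional

end

section

variable (M : ℕ) {V : Type*} [NormedAddCommGroup V] [InnerProductSpace ℝ V]

/-- The inner products of a vector with `e 0, …, e (M - 1)`, and the difference between the vector
and the combination of the `e t` with these coefficients. -/
noncomputable def splitOff (e : ℕ → V) : V →ₗ[ℝ] (Fin M → ℝ) × V :=
  LinearMap.prod (LinearMap.pi fun t => (innerₗ V) (e t))
    (LinearMap.id - ∑ t : Fin M, ((innerₗ V) (e t)).smulRight (e t))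

theorem splitOff_fst (e : ℕ → V) (u : V) (t : Fin M) : (splitOff M e u).1 t = inner ℝ (e t) u := rfl

theorem splitOff_snd (e : ℕ → V) (u : V) :
    (splitOff M e u).2 = u - ∑ t : Fin M, inner ℝ (e t) u • e t := by
  simp [splitOff]

theorem splitOff_injective (e : ℕ → V) : Function.Injective (splitOff M e) := by
  rw [injective_iff_map_eq_zero]
  intro u hu
  have h1 : ∀ t : Fin M, inner ℝ (e t) u = 0 := fun t => congrFun (congrArg Prod.fst hu) t
  have h2 := congrArg Prod.snd hu
  rw [splitOff_snd] at h2
  simpa [h1] using h2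

theorem splitOff_apply_self {e : ℕ → V} {q : Fin M}
    (he : ∀ t, inner ℝ (e t) (e q) = if t = q then 1 else 0) :
    splitOff M e (e q) = (Pi.single q 1, 0) := by
  refine Prod.ext (funext fun t => ?_) ?_
  · change _ = (Pi.single q 1 : Fin M → ℝ) t
    rw [splitOff_fst, he, Pi.single_apply]
    simp only [Fin.ext_iff]
  · rw [splitOff_snd, Finset.sum_eq_single q]
    · rw [he, if_pos rfl, one_smul, sub_self]
    · intro t _ ht
      rw [he, if_neg (fun h => ht (Fin.ext h)), zero_smul]
    · simp

theorem continuous_splitOff {Z : Type*} [TopologicalSpace Z] {e : ℕ → Z → V} {u : Z → V}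
    (he : ∀ t, Continuous (e t)) (hu : Continuous u) :
    Continuous fun z => splitOff M (fun t => e t z) (u z) := by
  refine Continuous.prodMk (continuous_pi fun t => (he t).inner hu) ?_
  refine Continuous.congr ?_ fun z => (splitOff_snd M (fun t => e t z) (u z)).symm
  exact hu.sub (continuous_finsetSum _ fun t _ => ((he t).inner hu).smul (he t))

end

theorem splitOff_equivariant (M : ℕ) {V : Type*} [NormedAddCommGroup V] [InnerProductSpace ℝ V]
    (τ : V →ₗᵢ[ℝ] V) {σ : ℕ → ℝ} (hσ : ∀ t, σ t * σ t = 1) (e : ℕ → V) (u : V) :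
    splitOff M (fun t => σ t • τ (e t)) (τ u) =
      (fun t : Fin M => σ t * (splitOff M e u).1 t, τ (splitOff M e u).2) := by
  refine Prod.ext (funext fun t => ?_) ?_
  · rw [splitOff_fst, real_inner_smul_left, τ.inner_map_map]
    rfl
  · simp only [splitOff_snd, map_sub, map_sum, map_smul]
    congr 1
    refine Finset.sum_congr rfl fun t _ => ?_
    rw [real_inner_smul_left, τ.inner_map_map, smul_smul]
    congr 1
    linear_combination (inner ℝ (e t) u) * hσ t

/-! ### The Hermite frame in a direct sum -/

/-- The Euclidean space `ℝ^N ⊕ ℝ^N'`. -/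
abbrev EuclideanSum (N N' : ℕ) : Type :=
  WithLp 2 (EuclideanSpace ℝ (Fin N) × EuclideanSpace ℝ (Fin N'))

section

variable {N N' : ℕ}

/-- The direct sum of two linear maps, with values in a Euclidean direct sum. -/
def pairMap {P P' : Type*} [AddCommMonoid P] [Module ℝ P] [AddCommMonoid P'] [Module ℝ P']
    (f : P →ₗ[ℝ] EuclideanSpace ℝ (Fin N)) (g : P' →ₗ[ℝ] EuclideanSpace ℝ (Fin N')) :
    P × P' →ₗ[ℝ] EuclideanSum N N' :=
  (WithLp.linearEquiv 2 ℝ _).symm.toLinearMap ∘ₗ f.prodMap g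

/-- The orthogonal projection of `ℝ^N ⊕ ℝ^N'` onto `W ⊕ W'`. -/
noncomputable def sumProj (W : Submodule ℝ (EuclideanSpace ℝ (Fin N)))
    (W' : Submodule ℝ (EuclideanSpace ℝ (Fin N'))) : EuclideanSum N N' →ₗ[ℝ] EuclideanSum N N' :=
  pairMap W.starProjection.toLinearMap W'.starProjection.toLinearMap ∘ₗ
    (WithLp.linearEquiv 2 ℝ _).toLinearMap

theorem pairMap_apply {P P' : Type*} [AddCommMonoid P] [Module ℝ P] [AddCommMonoid P']
    [Module ℝ P'] (f : P →ₗ[ℝ] EuclideanSpace ℝ (Fin N))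
    (g : P' →ₗ[ℝ] EuclideanSpace ℝ (Fin N')) (p : P × P') :
    pairMap f g p = WithLp.toLp 2 (f p.1, g p.2) := rfl

theorem pairMap_injective {P P' : Type*} [AddCommMonoid P] [Module ℝ P] [AddCommMonoid P']
    [Module ℝ P'] {f : P →ₗ[ℝ] EuclideanSpace ℝ (Fin N)}
    {g : P' →ₗ[ℝ] EuclideanSpace ℝ (Fin N')} (hf : Function.Injective f)
    (hg : Function.Injective g) : Function.Injective (pairMap f g) :=
  (WithLp.linearEquiv 2 ℝ _).symm.injective.comp (hf.prodMap hg)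

theorem sumProj_apply (W : Submodule ℝ (EuclideanSpace ℝ (Fin N)))
    (W' : Submodule ℝ (EuclideanSpace ℝ (Fin N'))) (v : EuclideanSum N N') :
    sumProj W W' v = WithLp.toLp 2 (W.starProjection v.fst, W'.starProjection v.snd) := rfl

theorem range_sumProj {P P' : Type*} [AddCommMonoid P] [Module ℝ P] [AddCommMonoid P']
    [Module ℝ P'] (f : P →ₗ[ℝ] EuclideanSpace ℝ (Fin N))
    (g : P' →ₗ[ℝ] EuclideanSpace ℝ (Fin N')) :
    LinearMap.range (sumProj (LinearMap.range f) (LinearMap.range g)) =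
      LinearMap.range (pairMap f g) := by
  apply le_antisymm
  · rintro _ ⟨v, rfl⟩
    obtain ⟨p, hp⟩ := (LinearMap.range f).starProjection_apply_mem v.fst
    obtain ⟨p', hp'⟩ := (LinearMap.range g).starProjection_apply_mem v.snd
    exact ⟨(p, p'), by rw [sumProj_apply, pairMap_apply, hp, hp']⟩
  · rintro _ ⟨p, rfl⟩
    refine ⟨pairMap f g p, ?_⟩
    rw [sumProj_apply, pairMap_apply]
    have h1 := Submodule.starProjection_eq_self_iff.2 (LinearMap.mem_range_self f p.1)
    have h2 := Submodule.starProjection_eq_self_iff.2 (LinearMap.mem_range_self g p.2)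
    change WithLp.toLp 2 ((LinearMap.range f).starProjection (f p.1),
      (LinearMap.range g).starProjection (g p.2)) = _
    rw [h1, h2]

/-- The vector whose components are the Taylor coefficients of the monomial `z ^ t` at `1` and,
up to signs that do not depend on `t`, at `-1`. -/
def hermiteVector (N N' t : ℕ) : EuclideanSum N N' :=
  WithLp.toLp 2 (WithLp.toLp 2 fun p => (t.choose p : ℝ),
    WithLp.toLp 2 fun p => (-1) ^ t * (t.choose p : ℝ))

theorem apply_eq_zero_of_starProjection_eq_zero {W : Submodule ℝ (EuclideanSpace ℝ (Fin N))}
    {q : Fin N} (hq : EuclideanSpace.single q 1 ∈ W) {v : EuclideanSpace ℝ (Fin N)}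
    (hv : W.starProjection v = 0) : v q = 0 := by
  have h := (Submodule.starProjection_apply_eq_zero_iff (K := W)).1 hv
  have := (Submodule.mem_orthogonal W v).1 h _ hq
  rw [EuclideanSpace.inner_single_left] at this
  simpa using this

/-- If `W` and `W'` contain the first `a` and `b` standard basis vectors, then the projections to
`W ⊕ W'` of the first `n ≤ a + b` Hermite vectors are independent. -/
theorem linearIndependent_sumProj_hermiteVector {W : Submodule ℝ (EuclideanSpace ℝ (Fin N))}
    {W' : Submodule ℝ (EuclideanSpace ℝ (Fin N'))} {a b n : ℕ} (ha : a ≤ N) (hb : b ≤ N')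
    (hW : ∀ q : Fin N, (q : ℕ) < a → EuclideanSpace.single q 1 ∈ W)
    (hW' : ∀ q : Fin N', (q : ℕ) < b → EuclideanSpace.single q 1 ∈ W') (hn : n ≤ a + b) :
    LinearIndependent ℝ fun r : Fin n => sumProj W W' (hermiteVector N N' r) := by
  rw [Fintype.linearIndependent_iff]
  intro g hg
  let l : ℕ → ℝ := fun t => if h : t < n then g ⟨t, h⟩ else 0
  have hl : ∀ t : Fin n, l t = g t := fun t => dif_pos t.2
  have hsum : ∑ r : Fin n, g r • sumProj W W' (hermiteVector N N' r) =
      sumProj W W' (∑ r : Fin n, g r • hermiteVector N N' r) := by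
    simp only [map_sum, map_smul]
  rw [hsum, sumProj_apply] at hg
  have h1 : W.starProjection (∑ r : Fin n, g r • hermiteVector N N' r).fst = 0 :=
    congrArg WithLp.fst hg
  have h2 : W'.starProjection (∑ r : Fin n, g r • hermiteVector N N' r).snd = 0 :=
    congrArg WithLp.snd hg
  rw [show (∑ r : Fin n, g r • hermiteVector N N' r).fst =
    ∑ r : Fin n, g r • (hermiteVector N N' r).fst from
      map_sum (WithLp.fstₗ 2 ℝ (EuclideanSpace ℝ (Fin N)) (EuclideanSpace ℝ (Fin N')))
        (fun r : Fin n => g r • hermiteVector N N' r) Finset.univ] at h1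
  rw [show (∑ r : Fin n, g r • hermiteVector N N' r).snd =
    ∑ r : Fin n, g r • (hermiteVector N N' r).snd from
      map_sum (WithLp.sndₗ 2 ℝ (EuclideanSpace ℝ (Fin N)) (EuclideanSpace ℝ (Fin N')))
        (fun r : Fin n => g r • hermiteVector N N' r) Finset.univ] at h2
  have key := eq_zero_of_taylor_eq_zero hn l (fun p hp => ?_) fun p hp => ?_
  · intro t
    rw [← hl]
    exact key t t.2
  · have := apply_eq_zero_of_starProjection_eq_zero (hW ⟨p, hp.trans_le ha⟩ hp) h1
    rw [Finset.sum_range]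
    simp only [hl]
    simpa [hermiteVector] using this
  · have := apply_eq_zero_of_starProjection_eq_zero (hW' ⟨p, hp.trans_le hb⟩ hp) h2
    rw [Finset.sum_range]
    simp only [hl]
    simpa [hermiteVector] using this

/-- The interchange of the summands of `ℝ^N ⊕ ℝ^N`. -/
noncomputable def sumSwap (N : ℕ) : EuclideanSum N N →ₗᵢ[ℝ] EuclideanSum N N where
  toLinearMap := (WithLp.linearEquiv 2 ℝ _).symm.toLinearMap ∘ₗ
    (LinearEquiv.prodComm ℝ _ _).toLinearMap ∘ₗ (WithLp.linearEquiv 2 ℝ _).toLinearMap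
  norm_map' v := by
    rw [← sq_eq_sq₀ (norm_nonneg _) (norm_nonneg _), WithLp.prod_norm_sq_eq_of_L2,
      WithLp.prod_norm_sq_eq_of_L2, add_comm]
    rfl

theorem sumSwap_apply (v : EuclideanSum N N) : sumSwap N v = WithLp.toLp 2 (v.snd, v.fst) := rfl

theorem range_sumSwap (N : ℕ) : LinearMap.range (sumSwap N).toLinearMap = ⊤ :=
  LinearMap.range_eq_top.2 fun v => ⟨sumSwap N v, rfl⟩

theorem sumProj_sumSwap (W W' : Submodule ℝ (EuclideanSpace ℝ (Fin N))) (v : EuclideanSum N N) :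
    sumProj W' W (sumSwap N v) = sumSwap N (sumProj W W' v) := rfl

theorem sumSwap_hermiteVector (t : ℕ) :
    sumSwap N (hermiteVector N N t) = (-1 : ℝ) ^ t • hermiteVector N N t := by
  have h : ((-1 : ℝ) ^ t) * (-1) ^ t = 1 := by rw [← mul_pow]; simp
  rw [sumSwap_apply]
  refine (WithLp.ofLp_injective 2) (Prod.ext ?_ ?_)
  · ext p
    simp [hermiteVector]
  · ext p
    simp [hermiteVector, ← mul_assoc, h]

end

section

variable {X Y : Type*} {N N' : ℕ} {k : ℕ} {A : ℕ → Set X} {A' : ℕ → Set Y} {c : ℕ → ℕ}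

/-- The part of `A k × A' k` over which the `t`-th vector of the Hermite frame has to be normalized:
the union of the `(X × Y)_j` with `t < c j`. -/
def normalizedPart (k : ℕ) (A : ℕ → Set X) (A' : ℕ → Set Y) (c : ℕ → ℕ) (t : ℕ) :
    Set (A k × A' k) :=
  {z | ∃ j ≤ k, t < c j ∧ ((z.1 : X), (z.2 : Y)) ∈ prodFiltration A A' j}

/-- The frame obtained, by orthogonalization with cut-offs, from the projections of the Hermite
vectors to the spaces `W x ⊕ W' y`. -/
noncomputable def jointFrame (c : ℕ → ℕ) (W : A k → Submodule ℝ (EuclideanSpace ℝ (Fin N)))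
    (W' : A' k → Submodule ℝ (EuclideanSpace ℝ (Fin N'))) (t : ℕ) :
    A k × A' k → EuclideanSum N N' :=
  cutoffGramSchmidt (normalizedPart k A A' c)
    (fun t z => sumProj (W z.1) (W' z.2) (hermiteVector N N' t)) t

theorem mem_prodFiltration {j : ℕ} {p : X × Y} :
    p ∈ prodFiltration A A' j ↔ ∃ i ≤ j, p.1 ∈ A i ∧ p.2 ∈ A' (j - i) := by
  simp only [prodFiltration, Set.mem_iUnion, Finset.mem_range, Set.mem_prod, Nat.lt_succ_iff,
    exists_prop]

theorem jointFrame_mem_range (W : A k → Submodule ℝ (EuclideanSpace ℝ (Fin N)))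
    (W' : A' k → Submodule ℝ (EuclideanSpace ℝ (Fin N'))) (t : ℕ) (z : A k × A' k) :
    jointFrame c W W' t z ∈ LinearMap.range (sumProj (W z.1) (W' z.2)) := by
  refine Submodule.span_le.2 ?_ (cutoffGramSchmidt_mem_span t z)
  rintro _ ⟨r, -, rfl⟩
  exact LinearMap.mem_range_self _ _

theorem jointFrame_swap (W : A k → Submodule ℝ (EuclideanSpace ℝ (Fin N))) (t : ℕ)
    (z : A k × A k) :
    jointFrame c W W t z.swap = (-1 : ℝ) ^ t • sumSwap N (jointFrame c W W t z) := by
  refine cutoffGramSchmidt_equivariant Prod.swap (sumSwap N) (fun t => (-1 : ℝ) ^ t)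
    (fun t => by rw [← mul_pow]; simp) (fun t z => ?_) t z
  rw [← sumProj_sumSwap, sumSwap_hermiteVector, map_smul, smul_smul, ← mul_pow]
  simp

theorem IsClosedFiltration.subset [TopologicalSpace X] (hA : IsClosedFiltration k A) {i j : ℕ} (hij : i ≤ j)
    (hj : j ≤ k) : A i ⊆ A j := by
  induction j, hij using Nat.le_induction with
  | base => exact le_rfl
  | succ j _ ih => exact (ih (by omega)).trans (hA.subset_succ j hj)

theorem fst_mem_of_mem_prodFiltration [TopologicalSpace X] (hA : IsClosedFiltration k A) {j : ℕ} (hj : j ≤ k)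
    {p : X × Y} (hp : p ∈ prodFiltration A A' j) : p.1 ∈ A k := by
  obtain ⟨i, hi, h, -⟩ := mem_prodFiltration.1 hp
  exact hA.subset (hi.trans hj) le_rfl h

theorem snd_mem_of_mem_prodFiltration [TopologicalSpace Y] (hA' : IsClosedFiltration k A') {j : ℕ} (hj : j ≤ k)
    {p : X × Y} (hp : p ∈ prodFiltration A A' j) : p.2 ∈ A' k := by
  obtain ⟨i, hi, -, h⟩ := mem_prodFiltration.1 hp
  exact hA'.subset ((Nat.sub_le _ _).trans hj) le_rfl h

theorem prodFiltration_mono [TopologicalSpace Y] {j j' : ℕ} (hjj : j ≤ j') (hj' : j' ≤ k)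
    (hA' : IsClosedFiltration k A') : prodFiltration A A' j ⊆ prodFiltration A A' j' := by
  intro p hp
  obtain ⟨i, hi, h, h'⟩ := mem_prodFiltration.1 hp
  exact mem_prodFiltration.2 ⟨i, hi.trans hjj, h, hA'.subset (by omega) (by omega) h'⟩

variable [TopologicalSpace X] [TopologicalSpace Y]

theorem isClosed_prodFiltration (hA : IsClosedFiltration k A) (hA' : IsClosedFiltration k A')
    {j : ℕ} (hj : j ≤ k) : IsClosed (prodFiltration A A' j) :=
  (Finset.range (j + 1)).finite_toSet.isClosed_biUnion fun i hi =>
    (hA.isClosed i (by have := Finset.mem_range.1 hi; omega)).prod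
      (hA'.isClosed (j - i) (by omega))

theorem isClosed_normalizedPart (hA : IsClosedFiltration k A) (hA' : IsClosedFiltration k A')
    (t : ℕ) : IsClosed (normalizedPart k A A' c t) := by
  have h : normalizedPart k A A' c t = ⋃ j ∈ {j | j ≤ k ∧ t < c j},
      (fun z : A k × A' k => ((z.1 : X), (z.2 : Y))) ⁻¹' prodFiltration A A' j := by
    ext z
    simp only [normalizedPart, Set.mem_ofPred_eq, Set.mem_iUnion, Set.mem_preimage, exists_prop,
      and_assoc]
  rw [h]
  refine ((Set.finite_Iic k).subset fun j hj => hj.1).isClosed_biUnion fun j hj =>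
    (isClosed_prodFiltration hA hA' hj.1).preimage (by fun_prop)

variable {W : A k → Submodule ℝ (EuclideanSpace ℝ (Fin N))}
  {W' : A' k → Submodule ℝ (EuclideanSpace ℝ (Fin N'))}

theorem continuous_sumProj (hW : ∀ v, Continuous fun x => (W x).starProjection v)
    (hW' : ∀ v, Continuous fun y => (W' y).starProjection v) (v : EuclideanSum N N') :
    Continuous fun z : A k × A' k => sumProj (W z.1) (W' z.2) v :=
  (WithLp.prod_continuous_toLp 2 _ _).comp
    (((hW _).comp continuous_fst).prodMk ((hW' _).comp continuous_snd))

theorem continuous_jointFrame (hW : ∀ v, Continuous fun x => (W x).starProjection v)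
    (hW' : ∀ v, Continuous fun y => (W' y).starProjection v) (t : ℕ) :
    Continuous (jointFrame c W W' t) :=
  continuous_cutoffGramSchmidt (fun _ => continuous_sumProj hW hW' _) t

theorem inner_jointFrame [CompactSpace (A k)] [CompactSpace (A' k)]
    (hA : IsClosedFiltration k A) (hA' : IsClosedFiltration k A')
    (hW : ∀ v, Continuous fun x => (W x).starProjection v)
    (hW' : ∀ v, Continuous fun y => (W' y).starProjection v)
    {a b : ℕ → ℕ} (ha : ∀ i ≤ k, a i ≤ N) (hb : ∀ i ≤ k, b i ≤ N')
    (hWa : ∀ i ≤ k, ∀ x : A k, x.1 ∈ A i → ∀ q : Fin N, q < a i →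
      EuclideanSpace.single q 1 ∈ W x)
    (hWb : ∀ i ≤ k, ∀ y : A' k, y.1 ∈ A' i → ∀ q : Fin N', q < b i →
      EuclideanSpace.single q 1 ∈ W' y)
    (hc : ∀ j ≤ k, ∀ i ≤ j, c j ≤ a i + b (j - i)) {r : ℕ} {z : A k × A' k}
    (hz : z ∈ normalizedPart k A A' c r) (t : ℕ) :
    inner ℝ (jointFrame c W W' t z) (jointFrame c W W' r z) = if t = r then 1 else 0 := by
  refine inner_cutoffGramSchmidt (fun t => continuous_sumProj hW hW' _)
    (fun t => (isClosed_normalizedPart hA hA' t).isCompact) ?_ ?_ r t hz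
  · rintro r t hrt z ⟨j, hj, ht, hm⟩
    exact ⟨j, hj, hrt.trans_lt ht, hm⟩
  · rintro t z ⟨j, hj, ht, hm⟩
    obtain ⟨i, hi, h1, h2⟩ := mem_prodFiltration.1 hm
    exact linearIndependent_sumProj_hermiteVector (ha i (hi.trans hj)) (hb (j - i) (by omega))
      (hWa i (hi.trans hj) z.1 h1) (hWb (j - i) (by omega) z.2 h2)
      ((Nat.succ_le_of_lt ht).trans (hc j hj i hi))

/-- The map that splits off the first `M` vectors of the joint frame, restricted to the image of
the projection to `W x ⊕ W' y`. -/
theorem isContFamily_jointFrame (hW : ∀ v, Continuous fun x => (W x).starProjection v)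
    (hW' : ∀ v, Continuous fun y => (W' y).starProjection v) (M : ℕ) :
    IsContFamily fun z : A k × A' k => encode M (EuclideanSum N N') ∘ₗ
      splitOff M (fun t => jointFrame c W W' t z) ∘ₗ sumProj (W z.1) (W' z.2) :=
  ⟨⟨_, fun _ _ q hq => encode_of_le M _ q hq⟩, fun v q => (continuous_encode_apply M q).comp
    (continuous_splitOff M (continuous_jointFrame hW hW') (continuous_sumProj hW hW' v))⟩

end

/-! ### The compatible system of liftings of the product -/

section

variable {B : Type*} [TopologicalSpace B] {F : Type*} [NormedAddCommGroup F]
  [NormedSpace ℝ F] {E : B → Type*} [∀ x, AddCommMonoid (E x)] [∀ x, Module ℝ (E x)]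
  [TopologicalSpace (TotalSpace F E)]

theorem continuous_starProjection_range [FiniteDimensional ℝ F] [∀ x, TopologicalSpace (E x)]
    [FiberBundle F E] [VectorBundle ℝ F E] {A : Set B} {N : ℕ}
    (ψ : ∀ x : A, E x →ₗ[ℝ] EuclideanSpace ℝ (Fin N)) (hψi : ∀ x, Function.Injective (ψ x))
    (hψ : Continuous fun p : {p : TotalSpace F E // p.proj ∈ A} => ψ ⟨p.1.proj, p.2⟩ p.1.2)
    (v : EuclideanSpace ℝ (Fin N)) :
    Continuous fun x => (LinearMap.range (ψ x)).starProjection v := by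
  refine continuous_iff_continuousAt.2 fun x₀ => ?_
  obtain ⟨m, hm, hev⟩ := exists_local_frame (F := F) ψ hψ x₀
  exact continuousAt_starProjection hm (hev.self_of_nhds.2.1 (hψi x₀))
    (hev.mono fun x hx => hx.1) v

theorem convMax_le {d d' : ℕ → ℕ} {D D' : ℕ} {j k : ℕ} (hj : j ≤ k) (hd : ∀ i ≤ k, d i ≤ D)
    (hd' : ∀ i ≤ k, d' i ≤ D') : convMax d d' j ≤ D + D' :=
  Finset.sup_le fun i hi => by
    have := Finset.mem_range.1 hi
    exact Nat.add_le_add (hd i (by omega)) (hd' (j - i) (by omega))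

theorem le_convMax (d d' : ℕ → ℕ) {i j : ℕ} (hi : i ≤ j) : d i + d' (j - i) ≤ convMax d d' j :=
  Finset.le_sup (f := fun i => d i + d' (j - i)) (Finset.mem_range.2 (Nat.lt_succ_of_le hi))

theorem convMax_succ {d d' : ℕ → ℕ} {k : ℕ} (hd : ∀ i < k, d i ≤ d (i + 1)) {j : ℕ}
    (hj : j < k) : convMax d d' j ≤ convMax d d' (j + 1) :=
  Finset.sup_le fun i hi => by
    have hi' := Finset.mem_range.1 hi
    refine le_trans ?_ (le_convMax d d' (i := i + 1) (j := j + 1) (by omega))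
    rw [Nat.add_sub_add_right]
    exact Nat.add_le_add_right (hd i (by omega)) _

theorem CompatLift.le_finrank {k : ℕ} {A : ℕ → Set B} {d : ℕ → ℕ} (L : CompatLift F E k A d)
    {i : ℕ} (hi : i ≤ k) : d i ≤ Module.finrank ℝ F :=
  (Nat.decreasingInduction' (P := fun j => d j ≤ d k)
    (fun n hn _ ih => (L.le_succ n hn).trans ih) hi le_rfl).trans L.le_dim

end

section

variable {X Y : Type*} {k : ℕ} {A : ℕ → Set X} {A' : ℕ → Set Y} {d d' : ℕ → ℕ} {N N' : ℕ}
  {F : Type*} {E : X → Type*} {F' : Type*} {E' : Y → Type*}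

theorem continuous_extProd_total [TopologicalSpace X] [TopologicalSpace Y]
    [TopologicalSpace (TotalSpace F E)] [TopologicalSpace (TotalSpace F' E')] :
    Continuous fun p : TotalSpace (F × F') (extProd E E') =>
    ((⟨p.1.1, p.2.1⟩ : TotalSpace F E), (⟨p.1.2, p.2.2⟩ : TotalSpace F' E')) := by
  have h := (FiberBundle.Prod.isInducing_diag F ((ContinuousMap.fst : C(X × Y, X)) *ᵖ E)
    F' ((ContinuousMap.snd : C(X × Y, Y)) *ᵖ E')).continuous
  exact ((Pullback.continuous_lift F E (ContinuousMap.fst : C(X × Y, X))).comp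
    (continuous_fst.comp h)).prodMk
      ((Pullback.continuous_lift F' E' (ContinuousMap.snd : C(X × Y, Y))).comp
        (continuous_snd.comp h))

theorem continuous_extProd_proj [TopologicalSpace X] [TopologicalSpace Y]
    [TopologicalSpace F] [TopologicalSpace F'] [∀ x, TopologicalSpace (E x)]
    [∀ y, TopologicalSpace (E' y)] [TopologicalSpace (TotalSpace F E)]
    [TopologicalSpace (TotalSpace F' E')] [FiberBundle F E] [FiberBundle F' E'] :
    Continuous (TotalSpace.proj : TotalSpace (F × F') (extProd E E') → X × Y) :=
  ((FiberBundle.continuous_proj F E).comp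
    (continuous_fst.comp continuous_extProd_total)).prodMk
      ((FiberBundle.continuous_proj F' E').comp (continuous_snd.comp continuous_extProd_total))

variable [NormedAddCommGroup F] [NormedSpace ℝ F]
  [∀ x, AddCommMonoid (E x)] [∀ x, Module ℝ (E x)]
  [NormedAddCommGroup F'] [NormedSpace ℝ F']
  [∀ y, AddCommMonoid (E' y)] [∀ y, Module ℝ (E' y)]

/-- The number `dim F + dim F' - e_j` of vectors of the joint frame that are orthonormal over
`(X × Y)_j`, where `e_j` is `convMax d d' j`. -/
noncomputable def codim (F F' : Type*) [NormedAddCommGroup F] [NormedSpace ℝ F]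
    [NormedAddCommGroup F'] [NormedSpace ℝ F'] (d d' : ℕ → ℕ) (j : ℕ) : ℕ :=
  Module.finrank ℝ (F × F') - convMax d d' j

/-- The embedding of `ℝ^N ⊕ ℝ^N'` into `ℝ^∞` at `z = (x, y)`: the first `dim F + dim F'` coordinates
are the inner products with the vectors of the joint frame of the images of `ψ` and `ψ'`, and the
others are those of the remainder after these components have been split off. It sends the `q`-th
frame vector to the `q`-th standard basis vector wherever that vector is normalized. -/
noncomputable def jointEncode (F F' : Type*) [NormedAddCommGroup F] [NormedSpace ℝ F]
    [NormedAddCommGroup F'] [NormedSpace ℝ F'] (d d' : ℕ → ℕ)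
    (ψ : ∀ x : A k, E x →ₗ[ℝ] EuclideanSpace ℝ (Fin N))
    (ψ' : ∀ y : A' k, E' y →ₗ[ℝ] EuclideanSpace ℝ (Fin N')) (z : A k × A' k) :
    EuclideanSum N N' →ₗ[ℝ] RInf :=
  encode (Module.finrank ℝ (F × F')) (EuclideanSum N N') ∘ₗ
    splitOff (Module.finrank ℝ (F × F')) fun t =>
      jointFrame (codim F F' d d') (fun x => LinearMap.range (ψ x))
        (fun y => LinearMap.range (ψ' y)) t z

theorem jointEncode_injective (ψ : ∀ x : A k, E x →ₗ[ℝ] EuclideanSpace ℝ (Fin N))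
    (ψ' : ∀ y : A' k, E' y →ₗ[ℝ] EuclideanSpace ℝ (Fin N')) (z : A k × A' k) :
    Function.Injective (jointEncode F F' d d' ψ ψ' z) :=
  (encode_injective _).comp (splitOff_injective _ _)

theorem splitOff_jointFrame_swap (c : ℕ → ℕ) (W : A k → Submodule ℝ (EuclideanSpace ℝ (Fin N)))
    (M : ℕ) (z : A k × A k) (u : EuclideanSum N N) :
    splitOff M (fun t => jointFrame c W W t z.swap) (sumSwap N u) =
      (fun t : Fin M => (-1 : ℝ) ^ (t : ℕ) * (splitOff M (fun t => jointFrame c W W t z) u).1 t,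
        sumSwap N (splitOff M (fun t => jointFrame c W W t z) u).2) := by
  rw [← splitOff_equivariant M (sumSwap N) (σ := fun t => (-1 : ℝ) ^ t)
    (fun t => by rw [← mul_pow]; simp)]
  simp only [jointFrame_swap]

/-- The interchange of factors multiplies the frame coordinates by signs. -/
theorem jointEncode_swap_apply (ψ : ∀ x : A k, E x →ₗ[ℝ] EuclideanSpace ℝ (Fin N))
    (z : A k × A k) (u : EuclideanSum N N) {q : ℕ} (hq : q < Module.finrank ℝ (F × F)) :
    jointEncode F F d d ψ ψ z.swap (sumSwap N u) q = (-1) ^ q * jointEncode F F d d ψ ψ z u q := by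
  refine (encode_of_lt _ _ ⟨q, hq⟩).trans
    (Eq.trans ?_ (congrArg _ (encode_of_lt _ _ ⟨q, hq⟩)).symm)
  rw [splitOff_jointFrame_swap]

theorem drop_jointEncode_swap_eq_zero_iff (ψ : ∀ x : A k, E x →ₗ[ℝ] EuclideanSpace ℝ (Fin N))
    (z : A k × A k) (u : EuclideanSum N N) {c : ℕ} (hc : c ≤ Module.finrank ℝ (F × F)) :
    RInf.drop c (jointEncode F F d d ψ ψ z.swap (sumSwap N u)) = 0 ↔
      RInf.drop c (jointEncode F F d d ψ ψ z u) = 0 := by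
  refine (drop_encode_eq_zero_iff _ hc _).trans
    (Iff.trans ?_ (drop_encode_eq_zero_iff _ hc _).symm)
  rw [splitOff_jointFrame_swap]
  simp only [mul_eq_zero, pow_eq_zero_iff', neg_eq_zero, one_ne_zero, false_and, false_or,
    map_eq_zero_iff (sumSwap N) (sumSwap N).injective]

end

section

variable {X Y : Type*} [TopologicalSpace X] [TopologicalSpace Y]
  {F : Type*} [NormedAddCommGroup F] [NormedSpace ℝ F] [FiniteDimensional ℝ F]
  {E : X → Type*} [∀ x, AddCommMonoid (E x)] [∀ x, Module ℝ (E x)]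
  [∀ x, TopologicalSpace (E x)] [TopologicalSpace (TotalSpace F E)]
  [FiberBundle F E] [VectorBundle ℝ F E]
  {F' : Type*} [NormedAddCommGroup F'] [NormedSpace ℝ F'] [FiniteDimensional ℝ F']
  {E' : Y → Type*} [∀ y, AddCommMonoid (E' y)] [∀ y, Module ℝ (E' y)]
  [∀ y, TopologicalSpace (E' y)] [TopologicalSpace (TotalSpace F' E')]
  [FiberBundle F' E'] [VectorBundle ℝ F' E']
  {k : ℕ} {A : ℕ → Set X} {A' : ℕ → Set Y} {d d' : ℕ → ℕ} {N N' : ℕ}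

/-- The part of `(X × Y)_j` as a subspace of `X_k × Y_k`. -/
def toProd (hA : IsClosedFiltration k A) (hA' : IsClosedFiltration k A') {j : ℕ} (hj : j ≤ k)
    (p : prodFiltration A A' j) : A k × A' k :=
  (⟨p.1.1, fst_mem_of_mem_prodFiltration hA hj p.2⟩,
    ⟨p.1.2, snd_mem_of_mem_prodFiltration hA' hj p.2⟩)

theorem continuous_toProd (hA : IsClosedFiltration k A) (hA' : IsClosedFiltration k A') {j : ℕ}
    (hj : j ≤ k) : Continuous (toProd hA hA' hj) :=
  ((continuous_fst.comp continuous_subtype_val).subtype_mk _).prodMk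
    ((continuous_snd.comp continuous_subtype_val).subtype_mk _)

theorem isContFamily_jointEncode (ψ : ∀ x : A k, E x →ₗ[ℝ] EuclideanSpace ℝ (Fin N))
    (hψi : ∀ x, Function.Injective (ψ x))
    (hψ : Continuous fun p : {p : TotalSpace F E // p.proj ∈ A k} => ψ ⟨p.1.proj, p.2⟩ p.1.2)
    (ψ' : ∀ y : A' k, E' y →ₗ[ℝ] EuclideanSpace ℝ (Fin N'))
    (hψi' : ∀ y, Function.Injective (ψ' y))
    (hψ' : Continuous fun p : {p : TotalSpace F' E' // p.proj ∈ A' k} =>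
      ψ' ⟨p.1.proj, p.2⟩ p.1.2) :
    IsContFamily fun z : A k × A' k => jointEncode F F' d d' ψ ψ' z ∘ₗ
      sumProj (LinearMap.range (ψ z.1)) (LinearMap.range (ψ' z.2)) :=
  isContFamily_jointFrame (c := codim F F' d d') (W := fun x => LinearMap.range (ψ x))
    (W' := fun y => LinearMap.range (ψ' y)) (continuous_starProjection_range ψ hψi hψ)
    (continuous_starProjection_range ψ' hψi' hψ') (Module.finrank ℝ (F × F'))

theorem continuous_jointEncode
    (hA : IsClosedFiltration k A) (hA' : IsClosedFiltration k A')
    (ψ : ∀ x : A k, E x →ₗ[ℝ] EuclideanSpace ℝ (Fin N))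
    (hψi : ∀ x, Function.Injective (ψ x))
    (hψ : Continuous fun p : {p : TotalSpace F E // p.proj ∈ A k} => ψ ⟨p.1.proj, p.2⟩ p.1.2)
    (ψ' : ∀ y : A' k, E' y →ₗ[ℝ] EuclideanSpace ℝ (Fin N'))
    (hψi' : ∀ y, Function.Injective (ψ' y))
    (hψ' : Continuous fun p : {p : TotalSpace F' E' // p.proj ∈ A' k} =>
      ψ' ⟨p.1.proj, p.2⟩ p.1.2) (q : ℕ) :
    Continuous fun p : {p : TotalSpace (F × F') (extProd E E') //
        p.proj ∈ prodFiltration A A' k} =>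
      jointEncode F F' d d' ψ ψ' (toProd hA hA' le_rfl ⟨p.1.proj, p.2⟩)
        (pairMap (ψ (toProd hA hA' le_rfl ⟨p.1.proj, p.2⟩).1)
          (ψ' (toProd hA hA' le_rfl ⟨p.1.proj, p.2⟩).2) p.1.2) q := by
  have hW := continuous_starProjection_range ψ hψi hψ
  have hW' := continuous_starProjection_range ψ' hψi' hψ'
  refine (continuous_encode_apply _ q).comp (continuous_splitOff _ (fun t =>
    (continuous_jointFrame hW hW' t).comp ((continuous_toProd hA hA' (le_refl k)).comp
      ((continuous_extProd_proj.comp continuous_subtype_val).subtype_mk fun p => p.2))) ?_)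
  have hl := continuous_extProd_total.comp (continuous_subtype_val
    (p := fun p : TotalSpace (F × F') (extProd E E') => p.proj ∈ prodFiltration A A' k))
  exact (WithLp.prod_continuous_toLp 2 _ _).comp
    ((hψ.comp ((continuous_fst.comp hl).subtype_mk
      fun p => fst_mem_of_mem_prodFiltration hA le_rfl p.2)).prodMk
    (hψ'.comp ((continuous_snd.comp hl).subtype_mk
      fun p => snd_mem_of_mem_prodFiltration hA' le_rfl p.2)))

/-- Over `(X × Y)_j`, the image of `θ × η` in `ℝ^∞` contains the first `dim F + dim F' - e_j`
standard basis vectors: the frame vectors lie in the fibres of `θ × η`. -/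
theorem single_mem_range_jointEncode [CompactSpace (A k)] [CompactSpace (A' k)]
    (hA : IsClosedFiltration k A) (hA' : IsClosedFiltration k A')
    (hdF : ∀ i ≤ k, d i ≤ Module.finrank ℝ F) (hdF' : ∀ i ≤ k, d' i ≤ Module.finrank ℝ F')
    (ψ : ∀ x : A k, E x →ₗ[ℝ] EuclideanSpace ℝ (Fin N)) (hN : Module.finrank ℝ F ≤ N)
    (hψi : ∀ x, Function.Injective (ψ x))
    (hψ : Continuous fun p : {p : TotalSpace F E // p.proj ∈ A k} => ψ ⟨p.1.proj, p.2⟩ p.1.2)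
    (hψs : ∀ i ≤ k, ∀ x : A k, x.1 ∈ A i → ∀ q : Fin N, q < Module.finrank ℝ F - d i →
        EuclideanSpace.single q 1 ∈ LinearMap.range (ψ x))
    (ψ' : ∀ y : A' k, E' y →ₗ[ℝ] EuclideanSpace ℝ (Fin N')) (hN' : Module.finrank ℝ F' ≤ N')
    (hψi' : ∀ y, Function.Injective (ψ' y))
    (hψ' : Continuous fun p : {p : TotalSpace F' E' // p.proj ∈ A' k} =>
      ψ' ⟨p.1.proj, p.2⟩ p.1.2)
    (hψs' : ∀ i ≤ k, ∀ y : A' k, y.1 ∈ A' i → ∀ q : Fin N', q < Module.finrank ℝ F' - d' i →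
        EuclideanSpace.single q 1 ∈ LinearMap.range (ψ' y))
    {j : ℕ} (hj : j ≤ k) {z : A k × A' k} (hp : ((z.1 : X), (z.2 : Y)) ∈ prodFiltration A A' j)
    {q : ℕ} (hq : q < codim F F' d d' j) :
    Finsupp.single q 1 ∈
      LinearMap.range (jointEncode F F' d d' ψ ψ' z ∘ₗ pairMap (ψ z.1) (ψ' z.2)) := by
  have hr : Module.finrank ℝ (F × F') = Module.finrank ℝ F + Module.finrank ℝ F' :=
    Module.finrank_prod
  have hW := continuous_starProjection_range ψ hψi hψ
  have hW' := continuous_starProjection_range ψ' hψi' hψ'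
  have hqM : q < Module.finrank ℝ (F × F') := hq.trans_le (Nat.sub_le _ _)
  have hin := inner_jointFrame hA hA' hW hW' (c := codim F F' d d')
    (a := fun i => Module.finrank ℝ F - d i) (b := fun i => Module.finrank ℝ F' - d' i)
    (fun i _ => (Nat.sub_le _ _).trans hN) (fun i _ => (Nat.sub_le _ _).trans hN') hψs hψs'
    (fun j hj i hi => by
      have h1 := le_convMax d d' hi
      have h2 := hdF i (by omega)
      have h3 := hdF' (j - i) (by omega)
      simp only [codim]
      omega) (r := q) (z := z) ⟨j, hj, hq, hp⟩
  have h3 : jointEncode F F' d d' ψ ψ' z (jointFrame (codim F F' d d')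
      (fun x => LinearMap.range (ψ x)) (fun y => LinearMap.range (ψ' y)) q z) =
      Finsupp.single q 1 := by
    rw [← encode_single (V := EuclideanSum N N') _ ⟨q, hqM⟩]
    exact congrArg (encode _ _) (splitOff_apply_self _ (q := ⟨q, hqM⟩) hin)
  have h4 := jointFrame_mem_range (c := codim F F' d d') (fun x => LinearMap.range (ψ x))
    (fun y => LinearMap.range (ψ' y)) q z
  rw [range_sumProj] at h4
  obtain ⟨v, hv⟩ := h4
  rw [← h3, ← hv]
  exact ⟨v, rfl⟩

/-- Over `(X × X)_j`, the subspaces at `(x, y)` and `(y, x)` that complement the first vectors of the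
joint frame are the ranges of families of linear maps with the same kernels. -/
theorem comp_swapMap_homotopic (hA : IsClosedFiltration k A)
    (ψ : ∀ x : A k, E x →ₗ[ℝ] EuclideanSpace ℝ (Fin N)) (hψi : ∀ x, Function.Injective (ψ x))
    (hψ : Continuous fun p : {p : TotalSpace F E // p.proj ∈ A k} => ψ ⟨p.1.proj, p.2⟩ p.1.2)
    {j n c : ℕ} (hj : j ≤ k) (hc : c ≤ Module.finrank ℝ (F × F))
    (f : C(prodFiltration A A j, BO n))
    (hf : ∀ p, (f p).carrier = LinearMap.range (RInf.drop c ∘ₗ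
      jointEncode F F d d ψ ψ (toProd hA hA hj p) ∘ₗ
        sumProj (LinearMap.range (ψ (toProd hA hA hj p).1))
          (LinearMap.range (ψ (toProd hA hA hj p).2)))) :
    (f.comp (swapMap A j)).Homotopic f := by
  let R : A k × A k → EuclideanSum N N →ₗ[ℝ] RInf := fun z => RInf.drop c ∘ₗ
    jointEncode F F d d ψ ψ z ∘ₗ sumProj (LinearMap.range (ψ z.1)) (LinearMap.range (ψ z.2))
  have hR : IsContFamily R := (isContFamily_jointEncode ψ hψi hψ ψ hψi hψ).drop c
  let z := toProd hA hA hj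
  have hz : Continuous z := continuous_toProd hA hA hj
  have h1 : IsContFamily fun p => R (z p) := hR.comp hz
  have h2 : IsContFamily fun p => R (z p).swap ∘ₗ (sumSwap N).toLinearMap :=
    (hR.comp (continuous_swap.comp hz)).comp_linearMap _
  refine h2.homotopic h1 (fun p => ?_) (fun p => ?_) hf
  · ext u
    have key := drop_jointEncode_swap_eq_zero_iff (F := F) (d := d) ψ (z p)
      (sumProj (LinearMap.range (ψ (z p).1)) (LinearMap.range (ψ (z p).2)) u) hc
    rw [← sumProj_sumSwap] at key
    rw [LinearMap.mem_ker, LinearMap.mem_ker]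
    exact key
  · rw [LinearMap.range_comp_of_range_eq_top _ (range_sumSwap N)]
    exact hf (swapMap A j p)

/-- Embeddings of `θ` and `η` into trivial bundles, whose images contain the standard basis vectors
that the filtration allows, induce a compatible system of liftings of `θ × η`. -/
theorem exists_compatLift_extProd [CompactSpace (A k)] [CompactSpace (A' k)]
    (hA : IsClosedFiltration k A) (hA' : IsClosedFiltration k A')
    (hd : ∀ i < k, d i ≤ d (i + 1))
    (hdF : ∀ i ≤ k, d i ≤ Module.finrank ℝ F) (hdF' : ∀ i ≤ k, d' i ≤ Module.finrank ℝ F')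
    (ψ : ∀ x : A k, E x →ₗ[ℝ] EuclideanSpace ℝ (Fin N)) (hN : Module.finrank ℝ F ≤ N)
    (hψi : ∀ x, Function.Injective (ψ x))
    (hψ : Continuous fun p : {p : TotalSpace F E // p.proj ∈ A k} => ψ ⟨p.1.proj, p.2⟩ p.1.2)
    (hψs : ∀ i ≤ k, ∀ x : A k, x.1 ∈ A i → ∀ q : Fin N, q < Module.finrank ℝ F - d i →
        EuclideanSpace.single q 1 ∈ LinearMap.range (ψ x))
    (ψ' : ∀ y : A' k, E' y →ₗ[ℝ] EuclideanSpace ℝ (Fin N')) (hN' : Module.finrank ℝ F' ≤ N')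
    (hψi' : ∀ y, Function.Injective (ψ' y))
    (hψ' : Continuous fun p : {p : TotalSpace F' E' // p.proj ∈ A' k} =>
      ψ' ⟨p.1.proj, p.2⟩ p.1.2)
    (hψs' : ∀ i ≤ k, ∀ y : A' k, y.1 ∈ A' i → ∀ q : Fin N', q < Module.finrank ℝ F' - d' i →
        EuclideanSpace.single q 1 ∈ LinearMap.range (ψ' y)) :
    ∃ L : CompatLift (F × F') (extProd E E') k (prodFiltration A A') (convMax d d'),
      (∀ (j : ℕ) (hj : j ≤ k) (p : prodFiltration A A' j), (L.map j p).carrier =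
        LinearMap.range (RInf.drop (codim F F' d d' j) ∘ₗ
          jointEncode F F' d d' ψ ψ' (toProd hA hA' hj p) ∘ₗ
            sumProj (LinearMap.range (ψ (toProd hA hA' hj p).1))
              (LinearMap.range (ψ' (toProd hA hA' hj p).2)))) ∧
      ∀ (p : prodFiltration A A' k) (a : E p.1.1) (b : E' p.1.2),
        (L.classify.fibre p ((a, b) : E p.1.1 × E' p.1.2) : RInf) =
          jointEncode F F' d d' ψ ψ' (toProd hA hA' le_rfl p)
            (WithLp.toLp 2 (ψ (toProd hA hA' le_rfl p).1 a, ψ' (toProd hA hA' le_rfl p).2 b)) := by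
  let z := toProd hA hA' (le_refl k)
  let Ψ : ∀ p : prodFiltration A A' k, extProd E E' p →ₗ[ℝ] RInf := fun p =>
    jointEncode F F' d d' ψ ψ' (z p) ∘ₗ pairMap (ψ (z p).1) (ψ' (z p).2)
  let R : prodFiltration A A' k → EuclideanSum N N' →ₗ[ℝ] RInf := fun p =>
    jointEncode F F' d d' ψ ψ' (z p) ∘ₗ
      sumProj (LinearMap.range (ψ (z p).1)) (LinearMap.range (ψ' (z p).2))
  have hr : Module.finrank ℝ (F × F') = Module.finrank ℝ F + Module.finrank ℝ F' :=
    Module.finrank_prod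
  have hE : ∀ p : prodFiltration A A' k, Nonempty (extProd E E' p ≃ₗ[ℝ] F × F') := fun p =>
    ⟨((trivializationAt F E p.1.1).linearEquivAt ℝ p.1.1
        (FiberBundle.mem_baseSet_trivializationAt' p.1.1)).prodCongr
      ((trivializationAt F' E' p.1.2).linearEquivAt ℝ p.1.2
        (FiberBundle.mem_baseSet_trivializationAt' p.1.2))⟩
  have hi : ∀ p, Function.Injective (Ψ p) := fun p =>
    (jointEncode_injective ψ ψ' (z p)).comp (pairMap_injective (hψi _) (hψi' _))
  have hc : ∀ q, Continuous fun p : {p : TotalSpace (F × F') (extProd E E') //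
      p.proj ∈ prodFiltration A A' k} => Ψ ⟨p.1.proj, p.2⟩ p.1.2 q :=
    continuous_jointEncode hA hA' ψ hψi hψ ψ' hψi' hψ'
  have hR : IsContFamily R :=
    (isContFamily_jointEncode ψ hψi hψ ψ' hψi' hψ').comp (g := z)
      (continuous_toProd hA hA' (le_refl k))
  have hRΨ : ∀ p, LinearMap.range (R p) = LinearMap.range (Ψ p) := fun p => by
    simp only [R, Ψ]
    rw [LinearMap.range_comp, range_sumProj]
    exact (LinearMap.range_comp _ _).symm
  have hs : ∀ j ≤ k, ∀ p : prodFiltration A A' k, p.1 ∈ prodFiltration A A' j →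
      ∀ q < Module.finrank ℝ (F × F') - convMax d d' j,
        Finsupp.single q 1 ∈ LinearMap.range (Ψ p) := fun j hj p hp q hq =>
    single_mem_range_jointEncode hA hA' hdF hdF' ψ hN hψi hψ hψs ψ' hN' hψi' hψ' hψs' hj
      (z := z p) hp hq
  obtain ⟨L, h1, h2⟩ := CompatLift.exists_of_embedding (F := F × F') (E := extProd E E')
    (A := prodFiltration A A') (d := convMax d d') (k := k) continuous_extProd_proj hE
    (fun j hj => prodFiltration_mono hj le_rfl hA') (fun j hj => convMax_succ hd hj)
    (fun j hj => hr ▸ convMax_le hj hdF hdF') Ψ hi hc R hR hRΨ hs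
  exact ⟨L, fun j hj p => h1 j hj p.1 p.2, fun p a b => h2 p (a, b)⟩

end

end CompatGD

open CompatGD in
theorem proposition2p5
    {X Y : Type*} [TopologicalSpace X] [CompactSpace X] [T2Space X]
    [TopologicalSpace Y] [CompactSpace Y] [T2Space Y]
    -- the vector bundle `θ = E` over `X`
    (F : Type*) [NormedAddCommGroup F] [NormedSpace ℝ F] [FiniteDimensional ℝ F]
    (E : X → Type*) [∀ x, AddCommMonoid (E x)] [∀ x, Module ℝ (E x)]
    [∀ x, TopologicalSpace (E x)] [TopologicalSpace (Bundle.TotalSpace F E)]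
    [FiberBundle F E] [VectorBundle ℝ F E]
    -- the vector bundle `η = E'` over `Y`
    (F' : Type*) [NormedAddCommGroup F'] [NormedSpace ℝ F'] [FiniteDimensional ℝ F']
    (E' : Y → Type*) [∀ y, AddCommMonoid (E' y)] [∀ y, Module ℝ (E' y)]
    [∀ y, TopologicalSpace (E' y)] [TopologicalSpace (Bundle.TotalSpace F' E')]
    [FiberBundle F' E'] [VectorBundle ℝ F' E']
    (k : ℕ) (A : ℕ → Set X) (A' : ℕ → Set Y) (d d' : ℕ → ℕ)
    (hA : IsClosedFiltration k A) (hA' : IsClosedFiltration k A')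
    (hd : GdLECompatibly F E k A d) (hd' : GdLECompatibly F' E' k A' d') :
    GdLECompatibly (F × F') (extProd E E') k (prodFiltration A A') (convMax d d') ∧
    ∃ L : CompatLift (F × F) (extProd E E) k (prodFiltration A A) (convMax d d),
      (∀ j ≤ k, ((L.map j).comp (swapMap A j)).Homotopic (L.map j)) ∧
      (∀ j ≤ k, ∀ (x y : X) (_ : (x, y) ∈ prodFiltration A A j)
        (h : (x, y) ∈ prodFiltration A A k) (h' : (y, x) ∈ prodFiltration A A k)
        (a : E x) (b : E y),
        ((a, b) : E x × E y) ∈ L.sub j ⟨(x, y), h⟩ →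
          ((b, a) : E y × E x) ∈ L.sub j ⟨(y, x), h'⟩) := by
  have : CompactSpace (A k) := isCompact_iff_compactSpace.1 (hA.isClosed k le_rfl).isCompact
  have : CompactSpace (A' k) := isCompact_iff_compactSpace.1 (hA'.isClosed k le_rfl).isCompact
  obtain ⟨L⟩ := hd
  obtain ⟨L'⟩ := hd'
  obtain ⟨N, ψ, hN, hψi, hψ, hψs⟩ := L.exists_embedding hA.subset_succ
  obtain ⟨N', ψ', hN', hψi', hψ', hψs'⟩ := L'.exists_embedding hA'.subset_succ
  refine ⟨?_, ?_⟩
  · obtain ⟨P, -, -⟩ := exists_compatLift_extProd hA hA' L.le_succ (fun i => L.le_finrank)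
      (fun i => L'.le_finrank) ψ hN hψi hψ hψs ψ' hN' hψi' hψ' hψs'
    exact ⟨P⟩
  obtain ⟨P, hPm, hPf⟩ := exists_compatLift_extProd hA hA L.le_succ (fun i => L.le_finrank)
    (fun i => L.le_finrank) ψ hN hψi hψ hψs ψ hN hψi hψ hψs
  refine ⟨P, fun j hj => comp_swapMap_homotopic hA ψ hψi hψ hj (Nat.sub_le _ _) (P.map j)
    (hPm j hj), ?_⟩
  · intro j hj x y _ h h' a b hab q hq
    have hqM : q < Module.finrank ℝ (F × F) := hq.trans_le (Nat.sub_le _ _)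
    let z : A k × A k := toProd hA hA le_rfl ⟨(x, y), h⟩
    have h1 : jointEncode F F d d ψ ψ z (WithLp.toLp 2 (ψ z.1 a, ψ z.2 b)) q = 0 :=
      (DFunLike.congr_fun (hPf ⟨(x, y), h⟩ a b) q).symm.trans (hab q hq)
    have h2 := jointEncode_swap_apply (F := F) (d := d) ψ z
      (WithLp.toLp 2 (ψ z.1 a, ψ z.2 b)) hqM
    rw [h1, mul_zero] at h2
    refine Eq.trans ?_ h2
    exact DFunLike.congr_fun (hPf ⟨(y, x), h'⟩ b a) q
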